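/- Let $n\ge 2$, $1<p<\infty$, $p'=p/(p-1)$. A weight is a non-negative locally integrable function $w$ on $\mathbb R^n$ that is positive almost everywhere; $w\in A_p$ means that $$[w]_{A_p}:=\sup_{Q}\Big(\frac1{|Q|}\int_Q w\,dx\Big)\Big(\frac1{|Q|}\int_Q w^{1-p'}\,dx\Big)^{p-1}<\infty,$$ the supremum being taken over all cubes $Q\subset\mathbb R^n$ with sides parallel to the coordinate axes. For $\lambda>0$, $R>0$ and a complex-valued Schwartz function $f$ on $\mathbb R^n$ let $$B^\lambda_Rf(x)=\int_{\mathbb R^n}\Big(1-\big(|\xi|/R\big)^2\Big)_+^{\lambda}\,\hat f(\xi)\,e^{2\pi i\xi\cdot x}\,d\xi,\qquad \hat f(\xi)=\int_{\mathbb R^n} f(x)\,e^{-2\pi i x\cdot\xi}\,dx,$$ $B^\lambda:=B^\lambda_1$ and $B^\lambda_*f(x)=\sup_{R>0}|B^\lambda_Rf(x)|$. For an operator $T$ defined on Schwartz functions let $\|T\|_{L^p(w)}$ be the supremum of $\|Tf\|_{L^p(w)}/\|f\|_{L^p(w)}$ over all nonzero Schwartz functions $f$, where $\|g\|_{L^p(w)}=\big(\int_{\mathbb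 R^n}|g|^p\,w\,dx\big)^{1/p}$. Let $\beta\in\mathbb R$. 1. If there is a constant $c$, independent of $w$, such that $\|B^{(n-1)/2}\|_{L^p(w)}\le c\,[w]_{A_p}^{\beta}$ for every $w\in A_p$, then $\beta\ge\max\{1,\tfrac1{p-1}\}$. 2. The same conclusion holds for the maximal operator: if there is a constant $c$, independent of $w$, such that $\|B_*^{(n-1)/2}\|_{L^p(w)}\le c\,[w]_{A_p}^{\beta}$ for every $w\in A_p$, then $\beta\ge\max\{1,\tfrac1{p-1}\}$. In other words, no such weighted bound for $B_*^{(n-1)/2}$ can hold with an exponent $\beta<\max\{1,\tfrac1{p-1}\}$. -/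

import Mathlib

open MeasureTheory
open scoped ENNReal FourierTransform SchwartzMap

noncomputable section

/-- The closed cube with sides parallel to the axes, lower corner `a` and side length `l`. -/
def axisCube {n : ℕ} (a : EuclideanSpace ℝ (Fin n)) (l : ℝ) : Set (EuclideanSpace ℝ (Fin n)) :=
  {x | ∀ i, a i ≤ x i ∧ x i ≤ a i + l}

/-- The Muckenhoupt constant `[w]_{A_p}`: the supremum over all cubes `Q` of
`(⨍_Q w) * (⨍_Q w ^ (1 - p'))^(p - 1)`, where `p' = p / (p - 1)`. It is computed in `[0, ∞]`,
where the negative power `1 - p'` of `0` is `∞`. -/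
def apConst {n : ℕ} (p : ℝ) (w : EuclideanSpace ℝ (Fin n) → ℝ) : ℝ≥0∞ :=
  ⨆ (a : EuclideanSpace ℝ (Fin n)) (l : ℝ) (_ : 0 < l),
    (⨍⁻ x in axisCube a l, ENNReal.ofReal (w x) ∂volume) *
      (⨍⁻ x in axisCube a l, ENNReal.ofReal (w x) ^ (1 - p.conjExponent) ∂volume) ^ (p - 1)

/-- `w ∈ A_p`: a non-negative locally integrable function with `[w]_{A_p} < ∞`. For such a function
positivity almost everywhere only excludes the degenerate weight `w = 0` a.e. -/
structure IsApWeight {n : ℕ} (p : ℝ) (w : EuclideanSpace ℝ (Fin n) → ℝ) : Prop where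
  nonneg : ∀ x, 0 ≤ w x
  pos_ae : ∀ᵐ x, 0 < w x
  locallyIntegrable : LocallyIntegrable w
  apConst_lt_top : apConst p w < ∞

/-- The norm of `L^p(w) = L^p(w(x) dx)`. -/
def weightedNorm {n : ℕ} {F : Type*} [ENorm F] (p : ℝ) (w : EuclideanSpace ℝ (Fin n) → ℝ)
    (g : EuclideanSpace ℝ (Fin n) → F) : ℝ≥0∞ :=
  eLpNorm g (ENNReal.ofReal p) (volume.withDensity fun x => ENNReal.ofReal (w x))

/-- The operator norm `‖T‖_{L^p(w)}` of an operator given on Schwartz functions (a dense subspace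
of `L^p(w)` for `w ∈ A_p`). -/
def weightedOpNorm {n : ℕ} {F : Type*} [ENorm F] (p : ℝ) (w : EuclideanSpace ℝ (Fin n) → ℝ)
    (T : (EuclideanSpace ℝ (Fin n) → ℂ) → EuclideanSpace ℝ (Fin n) → F) : ℝ≥0∞ :=
  ⨆ (f : 𝓢(EuclideanSpace ℝ (Fin n), ℂ)) (_ : f ≠ 0),
    weightedNorm p w (T f) / weightedNorm p w f

/-- The Bochner–Riesz operator `B^lam_R`:
`(B^lam_R f)(x) = ∫ (1 - (|ξ| / R)^2)_+ ^ lam * (𝓕 f)(ξ) * e^{2 π i ξ·x} dξ`,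
with `(𝓕 f)(ξ) = ∫ f(x) e^{-2 π i ξ·x} dx`. -/
def bochnerRiesz {n : ℕ} (lam R : ℝ) (f : EuclideanSpace ℝ (Fin n) → ℂ)
    (x : EuclideanSpace ℝ (Fin n)) : ℂ :=
  ∫ ξ, ((max (1 - (‖ξ‖ / R) ^ 2) 0 ^ lam : ℝ) : ℂ) * 𝓕 f ξ *
    Complex.exp (2 * Real.pi * Complex.I * (inner ℝ ξ x : ℝ))

/-- The maximal Bochner–Riesz operator `(B^lam_* f)(x) = sup_{R > 0} |(B^lam_R f)(x)|`. -/
def maximalBochnerRiesz {n : ℕ} (lam : ℝ) (f : EuclideanSpace ℝ (Fin n) → ℂ)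
    (x : EuclideanSpace ℝ (Fin n)) : ℝ≥0∞ :=
  ⨆ (R : ℝ) (_ : 0 < R), ‖bochnerRiesz lam R f x‖ₑ

end

/-!
The necessity of `max 1 (1 / (p - 1)) ≤ β` is shown with power weights, for the single operator
`B = B_1`; the maximal operator dominates it pointwise
(`weightedOpNorm_bochnerRiesz_le_maximal`).

Write the dimension as `n = m + 1`. At the critical index `m / 2 = (n - 1) / 2` the operator `B` is
the convolution with a radial kernel `K`, and slicing the unit ball shows that `K(x)` is a multiple
of `∫_{-1}^1 (1 - t ^ 2) ^ m e ^ (2 π i t |x|) dt` (`brKernel_eq_intervalIntegral`). Since `m` is an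
integer, repeated integration by parts replaces Bessel asymptotics: `K(x) = |x| ^ (-n) Φ(|x|)` up to
a relatively small error, where `Φ(r) = A e ^ (2 π i r) + B e ^ (-2 π i r)` with `A ≠ 0`
(`exists_brKernel_approx`). As `Φ(r)` and `Φ(r + 1 / 4)` are not small simultaneously, `|Φ| ≥ |A|`
on a set that carries a fixed proportion of the mass of `|x| ^ (-n - δ)` near infinity.

For `0 < δ ≤ 1` two weights are used.

* `w = |x| ^ (δ - n)`, with `[w] = O(1 / δ)`. For `f(y) = |y| ^ (-δ) conj (Φ(|y|))` far from the
  origin there is no cancellation in `B f` near the origin, and `‖B f‖ ≥ (c / δ) ‖f‖` in `L ^ p(w)`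
  (`exists_le_weightedOpNorm_singular`).
* `w = |x| ^ ((n - δ) (p - 1))`, with `[w] = O(δ ^ (1 - p))`. For `f(y) = |y| ^ (δ - n)` near the
  origin, the mass `1 / δ` of `f` is seen from afar like a point mass, and again
  `‖B f‖ ≥ (c / δ) ‖f‖` (`exists_le_weightedOpNorm_growing`).

Letting `δ → 0`, the first family forces `β ≥ 1` and the second `β ≥ 1 / (p - 1)`; negative `β` are
covered since `[w] ≥ 1` by Hölder's inequality (`one_le_apConst`, `one_div_le_of_forall_le`).
-/

noncomputable section

/-! ### The Bochner–Riesz kernel as a one-dimensional integral -/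

/-- The Bochner–Riesz multiplier `(1 - |ξ|^2)_+ ^ lam`, as a complex-valued function. -/
def brMultiplier {E : Type*} [Norm E] (lam : ℝ) (ξ : E) : ℂ :=
  ((max (1 - ‖ξ‖ ^ 2) 0 ^ lam : ℝ) : ℂ)

lemma max_one_sub_sq_rpow_eq_zero {lam r : ℝ} (hlam : 0 < lam) (hr : 1 ≤ |r|) :
    max (1 - r ^ 2) 0 ^ lam = 0 := by
  rw [max_eq_right (by rw [← sq_abs]; nlinarith), Real.zero_rpow hlam.ne']

lemma brMultiplier_eq_zero {E : Type*} [SeminormedAddGroup E] {lam : ℝ} (hlam : 0 < lam) {ξ : E}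
    (hξ : 1 ≤ ‖ξ‖) : brMultiplier lam ξ = 0 := by
  rw [brMultiplier, max_one_sub_sq_rpow_eq_zero hlam (hξ.trans (le_abs_self _)),
    Complex.ofReal_zero]

lemma continuous_brMultiplier {E : Type*} [SeminormedAddGroup E] {lam : ℝ} (hlam : 0 < lam) :
    Continuous (brMultiplier lam : E → ℂ) := by
  unfold brMultiplier
  refine Complex.continuous_ofReal.comp (Continuous.rpow_const (by fun_prop) fun _ => ?_)
  exact Or.inr hlam.le

lemma hasCompactSupport_brMultiplier {E : Type*} [SeminormedAddGroup E] [ProperSpace E] {lam : ℝ}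
    (hlam : 0 < lam) : HasCompactSupport (brMultiplier lam : E → ℂ) := by
  refine HasCompactSupport.intro (isCompact_closedBall (0 : E) 1) fun ξ hξ => ?_
  refine brMultiplier_eq_zero hlam ?_
  simpa using (not_le.1 (by simpa using hξ)).le

section InnerProductSpace

variable {E : Type*} [NormedAddCommGroup E] [InnerProductSpace ℝ E] [FiniteDimensional ℝ E]
  [MeasurableSpace E] [BorelSpace E]

lemma integrable_brMultiplier {lam : ℝ} (hlam : 0 < lam) :
    Integrable (brMultiplier lam : E → ℂ) :=
  have := FiniteDimensional.proper_real E
  (continuous_brMultiplier hlam).integrable_of_hasCompactSupport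
    (hasCompactSupport_brMultiplier hlam)

/-- The Bochner–Riesz kernel. The multiplier is even, so its Fourier transform and its inverse
Fourier transform agree. -/
def brKernel (lam : ℝ) (x : E) : ℂ := 𝓕 (brMultiplier lam : E → ℂ) x

lemma continuous_brKernel {lam : ℝ} (hlam : 0 < lam) :
    Continuous (brKernel lam : E → ℂ) :=
  VectorFourier.fourierIntegral_continuous Real.continuous_fourierChar
    (L := innerₗ E) continuous_inner (integrable_brMultiplier hlam)

/-- The Bochner–Riesz kernel is radial, because the Fourier transform commutes with isometries. -/
lemma brKernel_eq_of_norm_eq (lam : ℝ) {x y : E} (h : ‖x‖ = ‖y‖) :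
    brKernel lam x = brKernel lam y := by
  set A : E ≃ₗᵢ[ℝ] E := (ℝ ∙ (x - y))ᗮ.reflection
  have hA : A x = y := Submodule.reflection_sub h
  have hm : (brMultiplier lam : E → ℂ) ∘ A = brMultiplier lam := by
    ext ξ
    simp [brMultiplier]
  unfold brKernel
  rw [← hA, ← Real.fourier_comp_linearIsometry, hm]

end InnerProductSpace

/-- The Bochner–Riesz operator is the convolution with its kernel. -/
lemma bochnerRiesz_eq_integral_brKernel {n : ℕ} {lam : ℝ} (hlam : 0 < lam)
    (f : 𝓢(EuclideanSpace ℝ (Fin n), ℂ)) (x : EuclideanSpace ℝ (Fin n)) :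
    bochnerRiesz lam 1 f x = ∫ y, brKernel lam (x - y) * f y := by
  set g : EuclideanSpace ℝ (Fin n) → ℂ := fun ξ =>
    brMultiplier lam ξ * Complex.exp (2 * Real.pi * Complex.I * (inner ℝ ξ x : ℝ)) with hg
  have hgi : Integrable g := by
    refine Continuous.integrable_of_hasCompactSupport ?_
      (hasCompactSupport_brMultiplier hlam).mul_right
    refine (continuous_brMultiplier hlam).mul ?_
    fun_prop
  have h := VectorFourier.integral_fourierIntegral_smul_eq_flip
    (L := innerₗ (EuclideanSpace ℝ (Fin n))) (μ := volume) (ν := volume)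
    Real.continuous_fourierChar continuous_inner f.integrable hgi
  have h1 : bochnerRiesz lam 1 f x =
      ∫ ξ, VectorFourier.fourierIntegral Real.fourierChar volume
        (innerₗ (EuclideanSpace ℝ (Fin n))) f ξ • g ξ := by
    unfold bochnerRiesz
    congr 1
    ext ξ
    simp only [hg, brMultiplier, div_one, smul_eq_mul]
    change _ * 𝓕 (⇑f) ξ * _ = 𝓕 (⇑f) ξ * _
    ring
  rw [h1, h]
  congr 1
  ext y
  rw [smul_eq_mul, mul_comm]
  congr 1
  rw [brKernel_eq_of_norm_eq lam (norm_sub_rev x y), brKernel, flip_innerₗ]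
  change 𝓕 g y = _
  rw [Real.fourier_eq', Real.fourier_eq']
  congr 1
  ext ξ
  simp only [hg, smul_eq_mul, inner_sub_right]
  rw [mul_comm, mul_assoc, ← Complex.exp_add, mul_comm]
  congr 2
  push_cast
  ring

/-- Slicing the unit ball perpendicularly to a coordinate axis: the section at height `t` is a ball
of radius `√(1 - t ^ 2)`, which yields the factor `(1 - t ^ 2) ^ m` by scaling. -/
lemma integral_max_one_sub_sq_sub_rpow (m : ℕ) (hm : 0 < m) (t : ℝ) :
    (∫ η : Fin m → ℝ, max (1 - (t ^ 2 + ∑ i, η i ^ 2)) 0 ^ ((m : ℝ) / 2)) =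
      (∫ η : Fin m → ℝ, max (1 - ∑ i, η i ^ 2) 0 ^ ((m : ℝ) / 2)) * max (1 - t ^ 2) 0 ^ m := by
  have hm' : (0 : ℝ) < (m : ℝ) / 2 := by positivity
  rcases le_or_gt (1 - t ^ 2) 0 with ht | ht
  · have h0 : ∀ η : Fin m → ℝ, max (1 - (t ^ 2 + ∑ i, η i ^ 2)) 0 ^ ((m : ℝ) / 2) = 0 := by
      intro η
      have : 0 ≤ ∑ i, η i ^ 2 := Finset.sum_nonneg fun i _ => sq_nonneg _
      rw [max_eq_right (by linarith), Real.zero_rpow hm'.ne']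
    simp [h0, max_eq_right ht, hm.ne']
  · set s := 1 - t ^ 2 with hs
    have hss : √s ^ 2 = s := Real.sq_sqrt ht.le
    have hsp : 0 < √s := Real.sqrt_pos.2 ht
    have key := Measure.integral_comp_smul (volume : Measure (Fin m → ℝ))
      (fun η => max (1 - (t ^ 2 + ∑ i, η i ^ 2)) 0 ^ ((m : ℝ) / 2)) (√s)
    have h1 : ∀ η : Fin m → ℝ,
        max (1 - (t ^ 2 + ∑ i, (√s • η) i ^ 2)) 0 ^ ((m : ℝ) / 2) =
          √s ^ m * max (1 - ∑ i, η i ^ 2) 0 ^ ((m : ℝ) / 2) := by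
      intro η
      have e1 : 1 - (t ^ 2 + ∑ i, (√s • η) i ^ 2) = s * (1 - ∑ i, η i ^ 2) := by
        simp only [Pi.smul_apply, smul_eq_mul, mul_pow, hss, ← Finset.mul_sum]
        rw [hs]; ring
      have e2 : max (s * (1 - ∑ i, η i ^ 2)) 0 = s * max (1 - ∑ i, η i ^ 2) 0 := by
        rw [mul_max_of_nonneg _ _ ht.le, mul_zero]
      rw [e1, e2, Real.mul_rpow ht.le (le_max_right _ _)]
      congr 1
      rw [Real.sqrt_eq_rpow, ← Real.rpow_natCast, ← Real.rpow_mul ht.le]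
      congr 1
      ring
    simp only [h1] at key
    rw [integral_const_mul, Module.finrank_fin_fun, smul_eq_mul, abs_of_pos (by positivity)] at key
    rw [max_eq_left ht.le]
    have hp : (√s ^ m) ≠ 0 := by positivity
    have : (∫ η : Fin m → ℝ, max (1 - (t ^ 2 + ∑ i, η i ^ 2)) 0 ^ ((m : ℝ) / 2)) =
        √s ^ m * (√s ^ m * ∫ η : Fin m → ℝ, max (1 - ∑ i, η i ^ 2) 0 ^ ((m : ℝ) / 2)) := by
      rw [key]; field_simp
    rw [this, ← hss, ← pow_mul, ← mul_assoc, ← pow_add, mul_comm 2 m, mul_two, hss]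
    ring

/-- The integral of `(1 - |η| ^ 2)_+ ^ (m / 2)` over `ℝ ^ m`. -/
def sliceConst (m : ℕ) : ℝ := ∫ η : Fin m → ℝ, max (1 - ∑ i, η i ^ 2) 0 ^ ((m : ℝ) / 2)

lemma sliceConst_pos (m : ℕ) : 0 < sliceConst m := by
  unfold sliceConst
  rcases Nat.eq_zero_or_pos m with rfl | hm
  · simp [integral_const, Measure.real, volume_pi]
  refine Continuous.integral_pos_of_hasCompactSupport_nonneg_nonzero (x := 0) ?_ ?_ ?_ (by simp)
  · refine Continuous.rpow_const (by fun_prop) fun _ => Or.inr (by positivity)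
  · refine HasCompactSupport.intro (isCompact_closedBall (0 : Fin m → ℝ) 1) fun η hη => ?_
    have h1 : ∃ i, 1 < |η i| := by
      by_contra! h
      exact hη (by simpa using (pi_norm_le_iff_of_nonneg zero_le_one).2 h)
    obtain ⟨i, hi⟩ := h1
    have h2 : η i ^ 2 ≤ ∑ i, η i ^ 2 :=
      Finset.single_le_sum (f := fun i => η i ^ 2) (fun i _ => sq_nonneg _) (Finset.mem_univ i)
    have h3 : 1 < η i ^ 2 := by rw [← sq_abs]; nlinarith
    rw [max_eq_right (by linarith), Real.zero_rpow (by positivity)]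
  · intro η
    exact Real.rpow_nonneg (le_max_right _ _) _

/-- At the critical index `m / 2` in dimension `m + 1`, slicing turns the Bochner–Riesz kernel into
a one-dimensional Fourier integral of a polynomial. -/
lemma brKernel_eq_intervalIntegral (m : ℕ) (hm : 0 < m) (x : EuclideanSpace ℝ (Fin (m + 1))) :
    brKernel ((m : ℝ) / 2) x = sliceConst m *
      ∫ t in (-1 : ℝ)..1, (1 - (t : ℂ) ^ 2) ^ m *
        Complex.exp (Complex.I * (2 * Real.pi * ‖x‖ : ℝ) * t) := by
  have hm' : (0 : ℝ) < (m : ℝ) / 2 := by positivity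
  set y : EuclideanSpace ℝ (Fin (m + 1)) := EuclideanSpace.single 0 (-‖x‖) with hy
  have hxy : ‖x‖ = ‖y‖ := by simp [hy]
  have hint : Integrable fun ξ : EuclideanSpace ℝ (Fin (m + 1)) =>
      Complex.exp (Complex.I * (2 * Real.pi * ‖x‖ : ℝ) * ξ 0) * brMultiplier ((m : ℝ) / 2) ξ := by
    refine Continuous.integrable_of_hasCompactSupport ?_
      (hasCompactSupport_brMultiplier hm').mul_left
    refine Continuous.mul ?_ (continuous_brMultiplier hm')
    fun_prop
  set e := MeasurableEquiv.piFinSuccAbove (fun _ : Fin (m + 1) => ℝ) 0 with he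
  have hmp : MeasurePreserving (fun z : ℝ × (Fin m → ℝ) =>
      (WithLp.toLp 2 (e.symm z) : EuclideanSpace ℝ (Fin (m + 1)))) :=
    (PiLp.volume_preserving_toLp (Fin (m + 1))).comp
      (volume_preserving_piFinSuccAbove (fun _ : Fin (m + 1) => ℝ) 0).symm
  have hemb : MeasurableEmbedding (fun z : ℝ × (Fin m → ℝ) =>
      (WithLp.toLp 2 (e.symm z) : EuclideanSpace ℝ (Fin (m + 1)))) :=
    (MeasurableEquiv.toLp 2 (Fin (m + 1) → ℝ)).measurableEmbedding.comp
      e.symm.measurableEmbedding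
  have hval : ∀ z : ℝ × (Fin m → ℝ),
      Complex.exp (Complex.I * (2 * Real.pi * ‖x‖ : ℝ) *
        ((WithLp.toLp 2 (e.symm z) : EuclideanSpace ℝ (Fin (m + 1))) 0 : ℝ)) *
        brMultiplier ((m : ℝ) / 2) (WithLp.toLp 2 (e.symm z) : EuclideanSpace ℝ (Fin (m + 1))) =
      Complex.exp (Complex.I * (2 * Real.pi * ‖x‖ : ℝ) * z.1) *
        ((max (1 - (z.1 ^ 2 + ∑ i, z.2 i ^ 2)) 0 ^ ((m : ℝ) / 2) : ℝ) : ℂ) := by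
    rintro ⟨t, η⟩
    simp only [brMultiplier, EuclideanSpace.norm_sq_eq, Fin.sum_univ_succ]
    simp [he, MeasurableEquiv.piFinSuccAbove, Fin.insertNthEquiv]
  rw [brKernel_eq_of_norm_eq _ hxy, brKernel, Real.fourier_eq']
  have h0 : ∀ ξ : EuclideanSpace ℝ (Fin (m + 1)),
      Complex.exp (((-2 * Real.pi * inner ℝ ξ y : ℝ) : ℂ) * Complex.I) •
        brMultiplier ((m : ℝ) / 2) ξ =
      Complex.exp (Complex.I * (2 * Real.pi * ‖x‖ : ℝ) * ξ 0) * brMultiplier ((m : ℝ) / 2) ξ := by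
    intro ξ
    simp only [smul_eq_mul, hy, EuclideanSpace.inner_single_right]
    congr 2
    simp
    ring
  simp only [h0]
  rw [← hmp.integral_comp hemb]
  have hint2 := (hmp.integrable_comp_emb hemb).2 hint
  simp only [Function.comp_def, hval] at hint2
  simp only [hval]
  rw [Measure.volume_eq_prod] at hint2 ⊢
  rw [integral_prod _ hint2]
  have h2 : ∀ t : ℝ, (∫ η : Fin m → ℝ, Complex.exp (Complex.I * (2 * Real.pi * ‖x‖ : ℝ) * t) *
        ((max (1 - (t ^ 2 + ∑ i, η i ^ 2)) 0 ^ ((m : ℝ) / 2) : ℝ) : ℂ)) =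
      sliceConst m * (((max (1 - t ^ 2) 0 ^ m : ℝ) : ℂ) *
        Complex.exp (Complex.I * (2 * Real.pi * ‖x‖ : ℝ) * t)) := by
    intro t
    rw [integral_const_mul, integral_complex_ofReal, integral_max_one_sub_sq_sub_rpow m hm t,
      sliceConst]
    push_cast
    ring
  simp only [h2]
  rw [integral_const_mul]
  congr 1
  rw [intervalIntegral.integral_of_le (by norm_num), ← integral_Icc_eq_integral_Ioc,
    ← integral_indicator measurableSet_Icc]
  congr 1
  ext t
  by_cases ht : t ∈ Set.Icc (-1 : ℝ) 1
  · rw [Set.indicator_of_mem ht, max_eq_left (by nlinarith [ht.1, ht.2])]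
    push_cast
    ring
  · have h1 : 1 - t ^ 2 ≤ 0 := by
      have : 1 < |t| := by
        by_contra! h
        exact ht (abs_le.1 h)
      rw [← sq_abs]
      nlinarith
    rw [Set.indicator_of_notMem ht, max_eq_right h1]
    simp [hm.ne']

/-! ### Asymptotics of the kernel at infinity -/

/-- The Fourier integral of a polynomial over `[-1, 1]`. -/
def polyFourier (P : Polynomial ℂ) (a : ℝ) : ℂ :=
  ∫ t in (-1 : ℝ)..1, P.eval (t : ℂ) * Complex.exp (Complex.I * a * t)

lemma norm_exp_I_mul_mul (a t : ℝ) : ‖Complex.exp (Complex.I * a * t)‖ = 1 := by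
  rw [mul_assoc, mul_comm, ← Complex.ofReal_mul, Complex.norm_exp_ofReal_mul_I]

lemma norm_exp_I_mul (a : ℝ) : ‖Complex.exp (Complex.I * a)‖ = 1 := by
  rw [mul_comm, Complex.norm_exp_ofReal_mul_I]

lemma norm_exp_neg_I_mul (a : ℝ) : ‖Complex.exp (-(Complex.I * a))‖ = 1 := by
  rw [← mul_neg, ← Complex.ofReal_neg, norm_exp_I_mul]

lemma exists_norm_polyFourier_le (P : Polynomial ℂ) : ∃ C, ∀ a, ‖polyFourier P a‖ ≤ C := by
  refine ⟨∫ t in (-1 : ℝ)..1, ‖P.eval (t : ℂ)‖, fun a => ?_⟩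
  refine (intervalIntegral.norm_integral_le_integral_norm (by norm_num)).trans_eq ?_
  simp only [norm_mul, norm_exp_I_mul_mul, mul_one]

lemma mul_polyFourier (P : Polynomial ℂ) {a : ℝ} (ha : a ≠ 0) :
    a * polyFourier P a =
      -Complex.I * P.eval 1 * Complex.exp (Complex.I * a) +
        Complex.I * P.eval (-1) * Complex.exp (-(Complex.I * a)) +
        Complex.I * polyFourier P.derivative a := by
  have hIa : Complex.I * (a : ℂ) ≠ 0 := mul_ne_zero Complex.I_ne_zero (by exact_mod_cast ha)
  have h := intervalIntegral.integral_mul_deriv_eq_deriv_mul (a := -1) (b := 1)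
    (u := fun t : ℝ => P.eval (t : ℂ)) (u' := fun t : ℝ => P.derivative.eval (t : ℂ))
    (v := fun t : ℝ => Complex.exp (Complex.I * a * t) / (Complex.I * a))
    (v' := fun t : ℝ => Complex.exp (Complex.I * a * t))
    (fun t _ => (P.hasDerivAt (t : ℂ)).comp_ofReal)
    (fun t _ => by
      have h1 : HasDerivAt (fun z : ℂ => Complex.exp (Complex.I * a * z) / (Complex.I * a))
          (Complex.exp (Complex.I * a * (t : ℂ)) * (Complex.I * a * 1) / (Complex.I * a)) (t : ℂ) :=
        ((hasDerivAt_id (t : ℂ)).const_mul (Complex.I * (a : ℂ))).cexp.div_const _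
      rw [mul_one, mul_div_cancel_right₀ _ hIa] at h1
      exact h1.comp_ofReal)
    (Continuous.intervalIntegrable (by fun_prop) _ _)
    (Continuous.intervalIntegrable (by fun_prop) _ _)
  have ha' : (a : ℂ) ≠ 0 := by exact_mod_cast ha
  unfold polyFourier
  have h2 : (∫ t in (-1 : ℝ)..1, P.derivative.eval (t : ℂ) *
      (Complex.exp (Complex.I * a * t) / (Complex.I * a))) =
      (∫ t in (-1 : ℝ)..1, P.derivative.eval (t : ℂ) * Complex.exp (Complex.I * a * t)) /
        (Complex.I * a) := by
    rw [← intervalIntegral.integral_div]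
    congr 1
    ext t
    ring
  rw [h, h2]
  simp only [Complex.ofReal_one, mul_one, Complex.ofReal_neg, mul_neg]
  field_simp
  ring_nf
  simp only [Complex.I_sq]
  ring

lemma exists_norm_polyFourier_le_div (P : Polynomial ℂ) :
    ∃ C, ∀ a : ℝ, 0 < a → ‖polyFourier P a‖ ≤ C / a := by
  obtain ⟨C, hC⟩ := exists_norm_polyFourier_le P.derivative
  refine ⟨‖P.eval 1‖ + ‖P.eval (-1)‖ + C, fun a ha => ?_⟩
  rw [le_div_iff₀ ha]
  have h1 : ‖(a : ℂ) * polyFourier P a‖ = ‖polyFourier P a‖ * a := by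
    rw [norm_mul, Complex.norm_real, Real.norm_of_nonneg ha.le, mul_comm]
  rw [← h1, mul_polyFourier P ha.ne']
  refine (norm_add₃_le).trans ?_
  gcongr
  · simp
  · simp [norm_exp_neg_I_mul]
  · simpa using hC a

/-- A zero of order `k` at both endpoints makes the Fourier integral decay like `a ^ (-(k + 1))`,
with an explicit oscillating leading term. Each integration by parts lowers the order by one. -/
lemma exists_polyFourier_asymptotic (k : ℕ) :
    ∃ A B : ℂ, A ≠ 0 ∧ ∀ Q : Polynomial ℂ, ∃ C, ∀ a : ℝ, 0 < a →
      ‖(a : ℂ) ^ (k + 1) * polyFourier ((1 - Polynomial.X ^ 2) ^ k * Q) a -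
        (A * Q.eval 1 * Complex.exp (Complex.I * a) +
          B * Q.eval (-1) * Complex.exp (-(Complex.I * a)))‖ ≤ C / a := by
  induction k with
  | zero =>
    refine ⟨-Complex.I, Complex.I, by simp, fun Q => ?_⟩
    obtain ⟨C, hC⟩ := exists_norm_polyFourier_le_div Q.derivative
    refine ⟨C, fun a ha => ?_⟩
    rw [pow_zero, one_mul, zero_add, pow_one, mul_polyFourier Q ha.ne', add_sub_cancel_left]
    simpa using hC a ha
  | succ k ih =>
    obtain ⟨A, B, hA, h⟩ := ih
    refine ⟨-2 * (k + 1) * Complex.I * A, 2 * (k + 1) * Complex.I * B, ?_, fun Q => ?_⟩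
    · have : (k : ℂ) + 1 ≠ 0 := by exact_mod_cast k.succ_ne_zero
      simp [this, hA]
    set Q' : Polynomial ℂ := (1 - Polynomial.X ^ 2) * Q.derivative -
      Polynomial.C (2 * (k + 1) : ℂ) * Polynomial.X * Q with hQ'
    have hder : ((1 - Polynomial.X ^ 2) ^ (k + 1) * Q).derivative =
        (1 - Polynomial.X ^ 2) ^ k * Q' := by
      simp only [Polynomial.derivative_mul, Polynomial.derivative_pow, Polynomial.derivative_sub,
        Polynomial.derivative_one, Polynomial.derivative_X, hQ', map_mul, map_add, map_one,
        map_natCast, map_ofNat, Nat.add_sub_cancel]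
      push_cast
      ring
    obtain ⟨C, hC⟩ := h Q'
    refine ⟨C, fun a ha => ?_⟩
    refine le_of_eq_of_le ?_ (hC a ha)
    have h1 : (a : ℂ) ^ (k + 1 + 1) * polyFourier ((1 - Polynomial.X ^ 2) ^ (k + 1) * Q) a =
        Complex.I * ((a : ℂ) ^ (k + 1) * polyFourier ((1 - Polynomial.X ^ 2) ^ k * Q') a) := by
      rw [pow_succ, mul_assoc, mul_polyFourier _ ha.ne', hder]
      simp
      ring
    have e1 : Q'.eval 1 = -2 * (k + 1) * Q.eval 1 := by simp [hQ']
    have e2 : Q'.eval (-1) = 2 * (k + 1) * Q.eval (-1) := by simp [hQ']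
    rw [h1, e1, e2, ← one_mul ‖(a : ℂ) ^ (k + 1) * _ - _‖, ← Complex.norm_I, ← norm_mul]
    congr 1
    ring

/-- The oscillating profile `r ↦ A e ^ (2 π i r) + B e ^ (-2 π i r)` of the Bochner–Riesz kernel at
infinity. -/
def oscProfile (A B : ℂ) (r : ℝ) : ℂ :=
  A * Complex.exp (Complex.I * (2 * Real.pi * r : ℝ)) +
    B * Complex.exp (-(Complex.I * (2 * Real.pi * r : ℝ)))

lemma contDiff_oscProfile (A B : ℂ) {k : WithTop ℕ∞} : ContDiff ℝ k (oscProfile A B) := by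
  unfold oscProfile
  have h : ContDiff ℝ k fun r : ℝ => ((2 * Real.pi * r : ℝ) : ℂ) :=
    Complex.ofRealCLM.contDiff.comp (contDiff_const.mul contDiff_id)
  fun_prop

lemma continuous_oscProfile (A B : ℂ) : Continuous (oscProfile A B) :=
  (contDiff_oscProfile A B (k := 0)).continuous

lemma norm_oscProfile_le (A B : ℂ) (r : ℝ) : ‖oscProfile A B r‖ ≤ ‖A‖ + ‖B‖ := by
  refine (norm_add_le _ _).trans_eq ?_
  rw [norm_mul, norm_mul, norm_exp_I_mul, norm_exp_neg_I_mul, mul_one, mul_one]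

/-- A shift by a quarter period changes the relative sign of the two exponentials, so the profile
cannot be small at both `r` and `r + 1 / 4`. -/
lemma norm_le_oscProfile_or (A B : ℂ) (r : ℝ) :
    ‖A‖ ≤ ‖oscProfile A B r‖ ∨ ‖A‖ ≤ ‖oscProfile A B (r + 1 / 4)‖ := by
  have h1 : Complex.exp (Complex.I * (2 * Real.pi * (r + 1 / 4) : ℝ)) =
      Complex.exp (Complex.I * (2 * Real.pi * r : ℝ)) * Complex.I := by
    rw [show Complex.I * ((2 * Real.pi * (r + 1 / 4) : ℝ) : ℂ) =
      Complex.I * (2 * Real.pi * r : ℝ) + Real.pi / 2 * Complex.I by push_cast; ring,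
      Complex.exp_add, Complex.exp_pi_div_two_mul_I]
  have h2 : Complex.exp (-(Complex.I * (2 * Real.pi * (r + 1 / 4) : ℝ))) =
      Complex.exp (-(Complex.I * (2 * Real.pi * r : ℝ))) * -Complex.I := by
    rw [show -(Complex.I * ((2 * Real.pi * (r + 1 / 4) : ℝ) : ℂ)) =
      -(Complex.I * (2 * Real.pi * r : ℝ)) + -Real.pi / 2 * Complex.I by push_cast; ring,
      Complex.exp_add, Complex.exp_neg_pi_div_two_mul_I]
  have h3 : oscProfile A B r + -Complex.I * oscProfile A B (r + 1 / 4) =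
      2 * (A * Complex.exp (Complex.I * (2 * Real.pi * r : ℝ))) := by
    unfold oscProfile
    rw [h1, h2]
    ring_nf
    simp only [Complex.I_sq]
    ring
  have h4 := norm_add_le (oscProfile A B r) (-Complex.I * oscProfile A B (r + 1 / 4))
  rw [h3] at h4
  simp only [norm_mul, norm_exp_I_mul, norm_neg, Complex.norm_I] at h4
  simp only [Complex.norm_ofNat, mul_one, one_mul] at h4
  by_contra! h
  linarith

lemma norm_oscProfile_sub_le (A B : ℂ) (r s : ℝ) :
    ‖oscProfile A B r - oscProfile A B s‖ ≤
      2 * Real.pi * (‖A‖ + ‖B‖) * |r - s| := by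
  have key : ∀ u v : ℝ, ‖Complex.exp (Complex.I * u) - Complex.exp (Complex.I * v)‖ ≤ |u - v| := by
    intro u v
    have h1 : Complex.exp (Complex.I * u) - Complex.exp (Complex.I * v) =
        Complex.exp (Complex.I * v) * (Complex.exp (Complex.I * (u - v : ℝ)) - 1) := by
      rw [mul_sub, ← Complex.exp_add, mul_one]
      congr 2
      push_cast
      ring
    rw [h1, norm_mul, norm_exp_I_mul, one_mul]
    exact Real.norm_exp_I_mul_ofReal_sub_one_le
  have h1 : oscProfile A B r - oscProfile A B s =
      A * (Complex.exp (Complex.I * (2 * Real.pi * r : ℝ)) -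
        Complex.exp (Complex.I * (2 * Real.pi * s : ℝ))) +
      B * (Complex.exp (Complex.I * (-(2 * Real.pi * r) : ℝ)) -
        Complex.exp (Complex.I * (-(2 * Real.pi * s) : ℝ))) := by
    unfold oscProfile
    rw [← mul_neg, ← mul_neg, Complex.ofReal_neg, Complex.ofReal_neg]
    ring
  have h2 : |2 * Real.pi * r - 2 * Real.pi * s| = 2 * Real.pi * |r - s| := by
    rw [← mul_sub, abs_mul, abs_of_pos Real.two_pi_pos]
  have h3 : |-(2 * Real.pi * r) - -(2 * Real.pi * s)| = 2 * Real.pi * |r - s| := by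
    rw [← h2, ← abs_neg]
    ring_nf
  rw [h1]
  refine (norm_add_le _ _).trans ?_
  rw [norm_mul, norm_mul]
  have := key (2 * Real.pi * r) (2 * Real.pi * s)
  have := key (-(2 * Real.pi * r)) (-(2 * Real.pi * s))
  rw [h2] at *
  rw [h3] at *
  nlinarith [norm_nonneg A, norm_nonneg B]

lemma exists_brKernel_asymptotic (m : ℕ) (hm : 0 < m) :
    ∃ A B : ℂ, A ≠ 0 ∧ ∃ C, ∀ x : EuclideanSpace ℝ (Fin (m + 1)), 0 < ‖x‖ →
      ‖(‖x‖ : ℂ) ^ (m + 1) * brKernel ((m : ℝ) / 2) x - oscProfile A B ‖x‖‖ ≤ C / ‖x‖ := by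
  obtain ⟨A, B, hA, h⟩ := exists_polyFourier_asymptotic m
  obtain ⟨C, hC⟩ := h 1
  have hpi : (2 * Real.pi : ℂ) ≠ 0 := by simp [Real.pi_ne_zero]
  have hs : (sliceConst m : ℂ) ≠ 0 := by exact_mod_cast (sliceConst_pos m).ne'
  set c : ℂ := sliceConst m / (2 * Real.pi) ^ (m + 1) with hc
  refine ⟨c * A, c * B, mul_ne_zero (div_ne_zero hs (pow_ne_zero _ hpi)) hA,
    ‖c‖ * (C / (2 * Real.pi)), fun x hx => ?_⟩
  have h1 : brKernel ((m : ℝ) / 2) x = sliceConst m *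
      polyFourier ((1 - Polynomial.X ^ 2) ^ m * 1) (2 * Real.pi * ‖x‖) := by
    rw [brKernel_eq_intervalIntegral m hm, polyFourier]
    simp
  have h2 := hC (2 * Real.pi * ‖x‖) (by positivity)
  have h3 : (‖x‖ : ℂ) ^ (m + 1) * brKernel ((m : ℝ) / 2) x - oscProfile (c * A) (c * B) ‖x‖ =
      c * (((2 * Real.pi * ‖x‖ : ℝ) : ℂ) ^ (m + 1) *
        polyFourier ((1 - Polynomial.X ^ 2) ^ m * 1) (2 * Real.pi * ‖x‖) -
        (A * (1 : Polynomial ℂ).eval 1 * Complex.exp (Complex.I * (2 * Real.pi * ‖x‖ : ℝ)) +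
          B * (1 : Polynomial ℂ).eval (-1) *
            Complex.exp (-(Complex.I * (2 * Real.pi * ‖x‖ : ℝ))))) := by
    rw [h1, mul_sub, oscProfile, Polynomial.eval_one, Polynomial.eval_one]
    congr 1
    · rw [hc]
      push_cast
      rw [mul_pow (2 * Real.pi : ℂ)]
      have := pow_ne_zero (m + 1) hpi
      generalize (2 * Real.pi : ℂ) ^ (m + 1) = z at *
      field_simp
    · ring
  rw [h3, norm_mul]
  refine (mul_le_mul_of_nonneg_left h2 (norm_nonneg _)).trans_eq ?_
  field_simp

/-- Far from the origin, the Bochner–Riesz kernel is `|x| ^ (-n)` times the oscillating profile, up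
to a relatively small error that is uniform under small translations. -/
lemma exists_brKernel_approx (m : ℕ) (hm : 0 < m) :
    ∃ A B : ℂ, A ≠ 0 ∧ ∀ ε : ℝ, 0 < ε → ∃ ρ R : ℝ, 0 < ρ ∧ ρ ≤ 1 ∧ 1 ≤ R ∧
      ∀ x y : EuclideanSpace ℝ (Fin (m + 1)), R ≤ ‖x‖ → ‖y‖ ≤ ρ →
        ‖brKernel ((m : ℝ) / 2) (x - y) - oscProfile A B ‖x‖ / (‖x‖ : ℂ) ^ (m + 1)‖ ≤
          ε / ‖x‖ ^ (m + 1) := by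
  obtain ⟨A, B, hA, C, hC⟩ := exists_brKernel_asymptotic m hm
  refine ⟨A, B, hA, fun ε hε => ?_⟩
  set M := ‖A‖ + ‖B‖ with hM
  have hMp : 0 < M := by have := norm_pos_iff.2 hA; positivity
  have hC0 : 0 ≤ C := by
    have := (norm_nonneg _).trans (hC (EuclideanSpace.single 0 1) (by simp))
    simpa using this
  have hcont : ContinuousAt (fun q : ℝ => q ^ (m + 1)) 1 := by fun_prop
  obtain ⟨η, hη, hq⟩ := Metric.continuousAt_iff.1 hcont (ε / (3 * (M + C))) (by positivity)
  refine ⟨min 1 (min (η / 2) (ε / (6 * Real.pi * M))), 2 + 3 * C / ε,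
    lt_min one_pos (lt_min (by positivity) (by positivity)), min_le_left _ _, ?_, fun x y hx hy => ?_⟩
  · have : 0 ≤ 3 * C / ε := by positivity
    linarith
  have hy1 : ‖y‖ ≤ 1 := hy.trans (min_le_left _ _)
  have hy2 : ‖y‖ ≤ η / 2 := hy.trans ((min_le_right _ _).trans (min_le_left _ _))
  have hy3 : ‖y‖ ≤ ε / (6 * Real.pi * M) := hy.trans ((min_le_right _ _).trans (min_le_right _ _))
  have hCε : 0 ≤ 3 * C / ε := by positivity
  set r := ‖x‖ with hr
  set s := ‖x - y‖ with hs
  have hrs : |r - s| ≤ ‖y‖ := by simpa using abs_norm_sub_norm_le x (x - y)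
  have hs1 : 1 + 3 * C / ε ≤ s := by linarith [(abs_le.1 hrs).2]
  have hs0 : 0 < s := by linarith
  have hr0 : 0 < r := by linarith
  have hCs : C / s ≤ ε / 3 := by
    rw [div_le_iff₀ hs0]
    have : ε / 3 * (3 * C / ε) = C := by field_simp
    nlinarith
  have hCs' : C / s ≤ C := div_le_self hC0 (by linarith)
  set e : ℂ := (s : ℂ) ^ (m + 1) * brKernel ((m : ℝ) / 2) (x - y) - oscProfile A B s with he
  have hes : ‖e‖ ≤ C / s := hC (x - y) hs0
  have hqs : |(r / s) ^ (m + 1) - 1| ≤ ε / (3 * (M + C)) := by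
    have h1 : dist (r / s) 1 < η := by
      rw [Real.dist_eq, div_sub_one hs0.ne', abs_div, abs_of_pos hs0, div_lt_iff₀ hs0]
      nlinarith
    simpa [Real.dist_eq] using (hq h1).le
  have hsc : (s : ℂ) ≠ 0 := by exact_mod_cast hs0.ne'
  have hrc : (r : ℂ) ≠ 0 := by exact_mod_cast hr0.ne'
  have hsplit : brKernel ((m : ℝ) / 2) (x - y) - oscProfile A B r / (r : ℂ) ^ (m + 1) =
      ((((r / s) ^ (m + 1) - 1 : ℝ) : ℂ) * (oscProfile A B s + e) + e +
        (oscProfile A B s - oscProfile A B r)) / (r : ℂ) ^ (m + 1) := by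
    have h1 : oscProfile A B s + e = (s : ℂ) ^ (m + 1) * brKernel ((m : ℝ) / 2) (x - y) := by
      rw [he]; ring
    have h2 : e = (s : ℂ) ^ (m + 1) * brKernel ((m : ℝ) / 2) (x - y) - oscProfile A B s := he
    rw [h1, h2, eq_div_iff (pow_ne_zero _ hrc), sub_mul, div_mul_cancel₀ _ (pow_ne_zero _ hrc)]
    push_cast
    rw [div_pow]
    field_simp
    ring
  rw [hsplit, norm_div, norm_pow, Complex.norm_real, Real.norm_of_nonneg hr0.le]
  gcongr
  have t1 : ‖(((r / s) ^ (m + 1) - 1 : ℝ) : ℂ) * (oscProfile A B s + e)‖ ≤ ε / 3 := by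
    rw [norm_mul, Complex.norm_real, Real.norm_eq_abs]
    have h1 : ‖oscProfile A B s + e‖ ≤ M + C :=
      (norm_add_le _ _).trans (add_le_add (norm_oscProfile_le A B s) (hes.trans hCs'))
    refine (mul_le_mul hqs h1 (norm_nonneg _) (by positivity)).trans_eq ?_
    field_simp
  have t2 : ‖oscProfile A B s - oscProfile A B r‖ ≤ ε / 3 := by
    refine (norm_oscProfile_sub_le A B s r).trans ?_
    rw [abs_sub_comm, ← hM]
    refine (mul_le_mul_of_nonneg_left (hrs.trans hy3) (by positivity)).trans_eq ?_
    field_simp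
    norm_num
  refine norm_add₃_le.trans ?_
  linarith

/-! ### Integrals of powers of the norm -/

/-- The surface area of the unit sphere of `ℝ ^ (m + 1)`, as the total mass of the polar
decomposition `Measure.toSphere` of the volume. -/
def sphereArea (m : ℕ) : ℝ :=
  (volume : Measure (EuclideanSpace ℝ (Fin (m + 1)))).toSphere.real Set.univ

lemma sphereArea_pos (m : ℕ) : 0 < sphereArea m := by
  rw [sphereArea, Measure.toSphere_real_apply_univ, finrank_euclideanSpace_fin]
  have : 0 < (volume : Measure (EuclideanSpace ℝ (Fin (m + 1)))).real (Metric.ball 0 1) :=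
    ENNReal.toReal_pos (Metric.measure_ball_pos _ _ one_pos).ne' measure_ball_lt_top.ne
  positivity

/-- Polar coordinates for the Lebesgue integral of a radial function. -/
lemma lintegral_fun_norm (m : ℕ) {g : ℝ → ℝ≥0∞} (hg : Measurable g) :
    ∫⁻ x : EuclideanSpace ℝ (Fin (m + 1)), g ‖x‖ =
      ENNReal.ofReal (sphereArea m) * ∫⁻ r in Set.Ioi (0 : ℝ), ENNReal.ofReal (r ^ m) * g r := by
  set μ : Measure (EuclideanSpace ℝ (Fin (m + 1))) := volume with hμ
  have hdim : Module.finrank ℝ (EuclideanSpace ℝ (Fin (m + 1))) - 1 = m := by simp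
  have hm0 : MeasurableSet ({0}ᶜ : Set (EuclideanSpace ℝ (Fin (m + 1)))) :=
    (measurableSet_singleton _).compl
  have h1 : ∫⁻ x, g ‖x‖ ∂μ = ∫⁻ x : ({0}ᶜ : Set (EuclideanSpace ℝ (Fin (m + 1)))), g ‖x.1‖
      ∂(μ.comap (↑)) := by
    rw [lintegral_subtype_comap hm0 fun x => g ‖x‖, restrict_compl_singleton]
  have h2 := μ.measurePreserving_homeomorphUnitSphereProd.lintegral_comp_emb
    (Homeomorph.measurableEmbedding _)
    (fun z : Metric.sphere (0 : EuclideanSpace ℝ (Fin (m + 1))) 1 × Set.Ioi (0 : ℝ) => g z.2)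
  simp only [homeomorphUnitSphereProd_apply_snd_coe] at h2
  have hgm : Measurable fun r : Set.Ioi (0 : ℝ) => g r := hg.comp measurable_subtype_coe
  have hgm' : Measurable fun z : Metric.sphere (0 : EuclideanSpace ℝ (Fin (m + 1))) 1 ×
      Set.Ioi (0 : ℝ) => g z.2 := hgm.comp measurable_snd
  rw [h1, h2, lintegral_prod _ hgm'.aemeasurable]
  simp only [lintegral_const]
  rw [mul_comm, hdim, Measure.volumeIoiPow,
    lintegral_withDensity_eq_lintegral_mul _ (by fun_prop) hgm]
  congr 1
  · rw [sphereArea, ofReal_measureReal]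
  · exact lintegral_subtype_comap measurableSet_Ioi fun r => ENNReal.ofReal (r ^ m) * g r

lemma setLIntegral_norm_rpow (m : ℕ) (γ : ℝ) {S : Set ℝ} (hS : MeasurableSet S) :
    ∫⁻ x in {x : EuclideanSpace ℝ (Fin (m + 1)) | ‖x‖ ∈ S},
        ENNReal.ofReal (‖x‖ ^ (γ - (m + 1))) =
      ENNReal.ofReal (sphereArea m) *
        ∫⁻ r in S ∩ Set.Ioi 0, ENNReal.ofReal (r ^ (γ - 1)) := by
  have hS' : MeasurableSet {x : EuclideanSpace ℝ (Fin (m + 1)) | ‖x‖ ∈ S} := measurable_norm hS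
  have hF : Measurable fun r : ℝ => ENNReal.ofReal (r ^ (γ - (m + 1))) := by fun_prop
  rw [← lintegral_indicator hS']
  have h := lintegral_fun_norm m (hF.indicator hS)
  refine (lintegral_congr fun x => ?_).trans (h.trans ?_)
  · rfl
  congr 1
  rw [← setLIntegral_indicator hS]
  refine setLIntegral_congr_fun measurableSet_Ioi fun r (hr : 0 < r) => ?_
  by_cases hrS : r ∈ S
  · simp only [Set.indicator_of_mem hrS]
    rw [← ENNReal.ofReal_mul (by positivity), ← Real.rpow_natCast, ← Real.rpow_add hr]
    congr 2
    ring
  · simp [hrS]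

lemma lintegral_Ioo_rpow {δ R : ℝ} (hδ : 0 < δ) (hR : 0 ≤ R) :
    ∫⁻ r in Set.Ioo 0 R, ENNReal.ofReal (r ^ (δ - 1)) = ENNReal.ofReal (R ^ δ / δ) := by
  have hi : IntegrableOn (fun r : ℝ => r ^ (δ - 1)) (Set.Ioc 0 R) :=
    (intervalIntegrable_iff_integrableOn_Ioc_of_le hR).1
      (intervalIntegral.intervalIntegrable_rpow' (by linarith))
  rw [Measure.restrict_congr_set Ioo_ae_eq_Ioc, ← ofReal_integral_eq_lintegral_ofReal hi,
    ← intervalIntegral.integral_of_le hR, integral_rpow (Or.inl (by linarith))]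
  · simp [hδ.ne']
  · filter_upwards [ae_restrict_mem measurableSet_Ioc] with y hy
    exact Real.rpow_nonneg hy.1.le _

lemma lintegral_Ioi_rpow {δ R : ℝ} (hδ : 0 < δ) (hR : 0 < R) :
    ∫⁻ r in Set.Ioi R, ENNReal.ofReal (r ^ (-δ - 1)) = ENNReal.ofReal (R ^ (-δ) / δ) := by
  rw [← ofReal_integral_eq_lintegral_ofReal
    (integrableOn_Ioi_rpow_of_lt (by linarith) hR), integral_Ioi_rpow_of_lt (by linarith) hR]
  · congr 1
    rw [sub_add_cancel, neg_div_neg_eq]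
  · filter_upwards [ae_restrict_mem measurableSet_Ioi] with y hy
    exact Real.rpow_nonneg (hR.trans hy).le _

lemma lintegral_Ioo_rpow_of_pos {γ R N : ℝ} (hγ : γ ≠ 0) (hR : 0 < R) (hN : R ≤ N) :
    ∫⁻ r in Set.Ioo R N, ENNReal.ofReal (r ^ (γ - 1)) =
      ENNReal.ofReal ((N ^ γ - R ^ γ) / γ) := by
  have h0 : (0 : ℝ) ∉ Set.uIcc R N := by
    rw [Set.uIcc_of_le hN]
    exact fun h => absurd h.1 (not_le.2 hR)
  have hi : IntegrableOn (fun r : ℝ => r ^ (γ - 1)) (Set.Ioc R N) :=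
    (intervalIntegrable_iff_integrableOn_Ioc_of_le hN).1
      (intervalIntegral.intervalIntegrable_rpow (Or.inr h0))
  rw [Measure.restrict_congr_set Ioo_ae_eq_Ioc, ← ofReal_integral_eq_lintegral_ofReal hi,
    ← intervalIntegral.integral_of_le hN,
    integral_rpow (Or.inr ⟨fun h => hγ (by linarith), h0⟩), sub_add_cancel]
  filter_upwards [ae_restrict_mem measurableSet_Ioc] with y hy
  exact Real.rpow_nonneg (hR.trans hy.1).le _

/-- If `G` or its translate by `1 / 4` contains each point, then `G` carries a fixed proportion of
the mass of `r ^ (-1 - δ)` near infinity, and a bounded part of `G` suffices. -/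
lemma exists_le_lintegral_inter_Ioo {G : Set ℝ} (hG : MeasurableSet G)
    (hG' : ∀ r, r ∈ G ∨ r + 1 / 4 ∈ G) {δ R : ℝ} (hδ : 0 < δ) (hδ1 : δ ≤ 1) (hR : 1 ≤ R) :
    ∃ N, R ≤ N ∧ ENNReal.ofReal (R ^ (-δ) / (10 * δ)) ≤
      ∫⁻ r in G ∩ Set.Ioo R N, ENNReal.ofReal (r ^ (-δ - 1)) := by
  have hR0 : 0 < R := by linarith
  -- Half of the mass of `r ^ (-1 - δ)` over `(R, ∞)` lies below `N`.
  set N : ℝ := R * 2 ^ (1 / δ) with hN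
  have hRN : R ≤ N := le_mul_of_one_le_right hR0.le
    (Real.one_le_rpow (by norm_num) (by positivity))
  have hNδ : N ^ (-δ) = R ^ (-δ) / 2 := by
    rw [hN, Real.mul_rpow hR0.le (by positivity), ← Real.rpow_mul (by norm_num)]
    have : 1 / δ * -δ = -1 := by field_simp
    rw [this, Real.rpow_neg_one]
    ring
  refine ⟨N + 1, by linarith, ?_⟩
  set h : ℝ → ℝ≥0∞ := fun r => ENNReal.ofReal (r ^ (-δ - 1)) with hh
  have hhm : Measurable h := by fun_prop
  have hS : MeasurableSet (G ∩ Set.Ioo R (N + 1)) := hG.inter measurableSet_Ioo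
  set f : ℝ → ℝ≥0∞ := (G ∩ Set.Ioo R (N + 1)).indicator h with hf
  have hfm : Measurable f := hhm.indicator hS
  have hpt : ∀ r, (Set.Ioo R N).indicator h r ≤ f r + 4 * f (r + 1 / 4) := by
    intro r
    by_cases hr : r ∈ Set.Ioo R N
    · rw [Set.indicator_of_mem hr]
      rcases hG' r with hrG | hrG
      · rw [hf, Set.indicator_of_mem (show r ∈ G ∩ Set.Ioo R (N + 1) from
          ⟨hrG, hr.1, by linarith [hr.2]⟩)]
        exact le_self_add
      · rw [hf, Set.indicator_of_mem (show r + 1 / 4 ∈ G ∩ Set.Ioo R (N + 1) from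
          ⟨hrG, by linarith [hr.1], by linarith [hr.2]⟩)]
        refine le_trans ?_ le_add_self
        have hr0 : 0 < r := hR0.trans hr.1
        have h4 : (4 : ℝ≥0∞) = ENNReal.ofReal 4 := by simp
        simp only [hh]
        rw [h4, ← ENNReal.ofReal_mul (by norm_num)]
        apply ENNReal.ofReal_le_ofReal
        calc r ^ (-δ - 1) = 2 ^ (δ + 1) * (2 * r) ^ (-δ - 1) := by
              rw [Real.mul_rpow (by norm_num) hr0.le, ← mul_assoc, ← Real.rpow_add (by norm_num)]
              have : δ + 1 + (-δ - 1) = 0 := by ring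
              rw [this, Real.rpow_zero, one_mul]
          _ ≤ 4 * (r + 1 / 4) ^ (-δ - 1) := by
              gcongr ?_ * ?_
              · calc (2 : ℝ) ^ (δ + 1) ≤ 2 ^ (2 : ℝ) :=
                      Real.rpow_le_rpow_of_exponent_le (by norm_num) (by linarith)
                  _ = 4 := by norm_num
              · exact Real.rpow_le_rpow_of_nonpos (by linarith) (by linarith [hr.1]) (by linarith)
    · rw [Set.indicator_of_notMem hr]
      exact zero_le
  have hint : ∫⁻ r, (Set.Ioo R N).indicator h r ≤ 5 * ∫⁻ r, f r := by
    refine (lintegral_mono hpt).trans_eq ?_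
    rw [lintegral_add_left hfm, lintegral_const_mul _ (by fun_prop),
      lintegral_add_right_eq_self f (1 / 4)]
    ring
  rw [lintegral_indicator measurableSet_Ioo, lintegral_indicator hS,
    lintegral_Ioo_rpow_of_pos (neg_ne_zero.2 hδ.ne') hR0 hRN, hNδ] at hint
  have h5 : (5 : ℝ≥0∞) = ENNReal.ofReal 5 := by simp
  have h6 : ENNReal.ofReal ((R ^ (-δ) / 2 - R ^ (-δ)) / -δ) =
      5 * ENNReal.ofReal (R ^ (-δ) / (10 * δ)) := by
    rw [h5, ← ENNReal.ofReal_mul (by norm_num)]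
    congr 1
    field_simp
    norm_num
  rw [h6] at hint
  exact (ENNReal.mul_le_mul_iff_right (by simp) (by simp)).1 hint

lemma lintegral_ball_norm_rpow (m : ℕ) {δ R : ℝ} (hδ : 0 < δ) (hR : 0 ≤ R) :
    ∫⁻ x in Metric.ball (0 : EuclideanSpace ℝ (Fin (m + 1))) R,
        ENNReal.ofReal (‖x‖ ^ (δ - (m + 1))) = ENNReal.ofReal (sphereArea m * (R ^ δ / δ)) := by
  have h : Metric.ball (0 : EuclideanSpace ℝ (Fin (m + 1))) R = {x | ‖x‖ ∈ Set.Iio R} := by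
    ext x
    simp
  rw [h, setLIntegral_norm_rpow m δ measurableSet_Iio, Set.inter_comm, Set.Ioi_inter_Iio,
    lintegral_Ioo_rpow hδ hR, ENNReal.ofReal_mul (sphereArea_pos m).le]

lemma lintegral_norm_rpow_neg (m : ℕ) {δ R : ℝ} (hδ : 0 < δ) (hR : 0 < R) :
    ∫⁻ x in {x : EuclideanSpace ℝ (Fin (m + 1)) | R < ‖x‖},
        ENNReal.ofReal (‖x‖ ^ (-δ - (m + 1))) =
      ENNReal.ofReal (sphereArea m * (R ^ (-δ) / δ)) := by
  have h : {x : EuclideanSpace ℝ (Fin (m + 1)) | R < ‖x‖} = {x | ‖x‖ ∈ Set.Ioi R} := rfl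
  rw [h, setLIntegral_norm_rpow m (-δ) measurableSet_Ioi, Set.Ioi_inter_Ioi, max_eq_left hR.le,
    lintegral_Ioi_rpow hδ hR, ENNReal.ofReal_mul (sphereArea_pos m).le]

lemma exists_le_lintegral_norm_rpow_neg (m : ℕ) {G : Set ℝ} (hG : MeasurableSet G)
    (hG' : ∀ r, r ∈ G ∨ r + 1 / 4 ∈ G) {δ R : ℝ} (hδ : 0 < δ) (hδ1 : δ ≤ 1) (hR : 1 ≤ R) :
    ∃ N, R ≤ N ∧ ENNReal.ofReal (sphereArea m * (R ^ (-δ) / (10 * δ))) ≤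
      ∫⁻ x in {x : EuclideanSpace ℝ (Fin (m + 1)) | ‖x‖ ∈ G ∩ Set.Ioo R N},
        ENNReal.ofReal (‖x‖ ^ (-δ - (m + 1))) := by
  obtain ⟨N, hN, h⟩ := exists_le_lintegral_inter_Ioo hG hG' hδ hδ1 hR
  refine ⟨N, hN, ?_⟩
  have hsub : (G ∩ Set.Ioo R N) ∩ Set.Ioi 0 = G ∩ Set.Ioo R N :=
    Set.inter_eq_left.2 fun r hr => (zero_lt_one.trans_le hR).trans hr.2.1
  rw [setLIntegral_norm_rpow m (-δ) (hG.inter measurableSet_Ioo), hsub,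
    ENNReal.ofReal_mul (sphereArea_pos m).le]
  gcongr

/-! ### Muckenhoupt constants of power weights -/

lemma axisCube_eq_preimage {n : ℕ} (a : EuclideanSpace ℝ (Fin n)) (l : ℝ) :
    axisCube a l = (WithLp.ofLp : EuclideanSpace ℝ (Fin n) → Fin n → ℝ) ⁻¹'
      Set.Icc (WithLp.ofLp a) (fun i => a i + l) := by
  ext x
  simp [axisCube, Pi.le_def, forall_and]

lemma measurableSet_axisCube {n : ℕ} (a : EuclideanSpace ℝ (Fin n)) (l : ℝ) :
    MeasurableSet (axisCube a l) := by
  rw [axisCube_eq_preimage]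
  exact (PiLp.volume_preserving_ofLp (Fin n)).measurable measurableSet_Icc

lemma volume_axisCube {n : ℕ} (a : EuclideanSpace ℝ (Fin n)) (l : ℝ) :
    volume (axisCube a l) = ENNReal.ofReal l ^ n := by
  rw [axisCube_eq_preimage,
    (PiLp.volume_preserving_ofLp (Fin n)).measure_preimage measurableSet_Icc.nullMeasurableSet,
    Real.volume_Icc_pi]
  simp

lemma norm_sub_le_of_mem_axisCube {n : ℕ} {a x : EuclideanSpace ℝ (Fin n)} {l : ℝ} (hl : 0 < l)
    (hx : x ∈ axisCube a l) : ‖x - a‖ ≤ n * l := by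
  have h1 : ‖x - a‖ ^ 2 ≤ n * l ^ 2 := by
    rw [EuclideanSpace.norm_sq_eq]
    calc ∑ i, ‖(x - a) i‖ ^ 2 ≤ ∑ _i : Fin n, l ^ 2 := by
          refine Finset.sum_le_sum fun i _ => ?_
          have := hx i
          rw [Real.norm_eq_abs, sq_abs]
          simp only [PiLp.sub_apply]
          nlinarith
      _ = n * l ^ 2 := by simp
  have h2 : (n : ℝ) ≤ (n : ℝ) ^ 2 := by
    exact_mod_cast Nat.le_self_pow two_ne_zero n
  refine abs_le_of_sq_le_sq' ?_ (by positivity) |>.2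
  nlinarith [sq_nonneg l]

lemma setLAverage_le_of_forall_le {α : Type*} [MeasurableSpace α] {μ : Measure α} {s : Set α}
    (hs : MeasurableSet s) {f : α → ℝ≥0∞} {c : ℝ≥0∞} (h : ∀ x ∈ s, f x ≤ c) :
    ⨍⁻ x in s, f x ∂μ ≤ c := by
  rw [setLAverage_eq]
  refine ENNReal.div_le_of_le_mul ?_
  exact (setLIntegral_mono' hs h).trans_eq (by simp)

/-- The average of `|x| ^ (δ - n)` over a cube is at most `C / δ` times its smallest value. Cubes
that are far from the origin compared with their size satisfy this without the factor `1 / δ`. -/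
lemma exists_setLAverage_norm_rpow_le (m : ℕ) :
    ∃ C : ℝ, 0 < C ∧ ∀ δ : ℝ, 0 < δ → δ ≤ 1 →
      ∀ (a : EuclideanSpace ℝ (Fin (m + 1))) (l : ℝ), 0 < l → ∃ M : ℝ, 0 < M ∧
        (∀ x ∈ axisCube a l, ‖x‖ ≤ M) ∧
        (⨍⁻ x in axisCube a l, ENNReal.ofReal (‖x‖ ^ (δ - (m + 1))) ∂volume) ≤
          ENNReal.ofReal (C / δ * M ^ (δ - (m + 1))) := by
  have hσ := sphereArea_pos m
  refine ⟨3 ^ (m + 1) + sphereArea m * (3 * (m + 1)) ^ (m + 1), by positivity,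
    fun δ hδ hδ1 a l hl => ?_⟩
  set D : ℝ := (m + 1) * l with hD
  have hDp : 0 < D := by positivity
  have hdist : ∀ x ∈ axisCube a l, ‖x - a‖ ≤ D := fun x hx => by
    simpa [hD] using norm_sub_le_of_mem_axisCube hl hx
  -- Far cubes have `|x|` comparable to `|a|`; the others are contained in the ball of radius `3 D`.
  rcases le_or_gt (2 * D) ‖a‖ with ha | ha
  · refine ⟨3 / 2 * ‖a‖, by linarith, fun x hx => ?_, ?_⟩
    · have h1 := hdist x hx
      have h2 := norm_sub_norm_le x a
      linarith
    refine setLAverage_le_of_forall_le (measurableSet_axisCube a l) fun x hx => ?_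
    apply ENNReal.ofReal_le_ofReal
    have h1 := hdist x hx
    have h2 := norm_sub_norm_le a x
    rw [norm_sub_rev] at h2
    set M := 3 / 2 * ‖a‖ with hM
    have hMp : 0 < M := by linarith
    have hx : M / 3 ≤ ‖x‖ := by linarith
    have hm : (0 : ℝ) ≤ m := by positivity
    calc ‖x‖ ^ (δ - (m + 1)) ≤ (M / 3) ^ (δ - (m + 1)) :=
          Real.rpow_le_rpow_of_nonpos (by positivity) hx (by linarith)
      _ = 3 ^ (m + 1 - δ) * M ^ (δ - (m + 1)) := by
          rw [Real.div_rpow hMp.le (by norm_num), div_eq_mul_inv, ← Real.rpow_neg (by norm_num),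
            neg_sub, mul_comm]
      _ ≤ 3 ^ (m + 1) * M ^ (δ - (m + 1)) := by
          gcongr
          rw [← Real.rpow_natCast]
          refine Real.rpow_le_rpow_of_exponent_le (by norm_num) ?_
          push_cast
          linarith
      _ ≤ _ := by
          gcongr
          rw [le_div_iff₀ hδ]
          have h3 : (0 : ℝ) ≤ sphereArea m * (3 * (m + 1)) ^ (m + 1) := by positivity
          have h4 : (0 : ℝ) < 3 ^ (m + 1) := by positivity
          nlinarith
  · have hlt : ∀ x ∈ axisCube a l, ‖x‖ < 3 * D := fun x hx => by
      have h1 := hdist x hx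
      have h2 := norm_sub_norm_le x a
      linarith
    refine ⟨3 * D, by positivity, fun x hx => (hlt x hx).le, ?_⟩
    have hsub : axisCube a l ⊆ Metric.ball 0 (3 * D) := fun x hx => by simpa using hlt x hx
    rw [setLAverage_eq, volume_axisCube]
    refine ENNReal.div_le_of_le_mul ?_
    refine (lintegral_mono_set hsub).trans ?_
    rw [lintegral_ball_norm_rpow m hδ (by positivity), ← ENNReal.ofReal_pow hl.le,
      ← ENNReal.ofReal_mul (by positivity)]
    apply ENNReal.ofReal_le_ofReal
    have h1 : (3 * D) ^ (δ - (m + 1)) * (3 * (m + 1) * l) ^ (m + 1) = (3 * D) ^ δ := by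
      rw [show 3 * ((m : ℝ) + 1) * l = 3 * D by rw [hD]; ring, ← Real.rpow_natCast,
        ← Real.rpow_add (by positivity)]
      congr 1
      push_cast
      ring
    rw [← h1, mul_pow (3 * ((m : ℝ) + 1)) l]
    have h3 : (0 : ℝ) ≤ 3 ^ (m + 1) * (3 * D) ^ (δ - (m + 1)) * l ^ (m + 1) / δ := by positivity
    have h4 : (3 ^ (m + 1) + sphereArea m * (3 * (m + 1)) ^ (m + 1)) / δ *
        (3 * D) ^ (δ - (m + 1)) * l ^ (m + 1) =
        3 ^ (m + 1) * (3 * D) ^ (δ - (m + 1)) * l ^ (m + 1) / δ +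
        sphereArea m * ((3 * D) ^ (δ - (m + 1)) * ((3 * (m + 1)) ^ (m + 1) * l ^ (m + 1)) / δ) := by
      ring
    rw [h4]
    linarith

/-- Hölder's inequality on a unit cube. -/
lemma one_le_apConst {n : ℕ} {p : ℝ} (hp : 1 < p) {w : EuclideanSpace ℝ (Fin n) → ℝ}
    (hw : IsApWeight p w) : 1 ≤ apConst p w := by
  have hpq : p.HolderConjugate p.conjExponent := Real.HolderConjugate.conjExponent hp
  set q := p.conjExponent with hq
  have hwm : AEMeasurable w (volume.restrict (axisCube (0 : EuclideanSpace ℝ (Fin n)) 1)) :=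
    hw.locallyIntegrable.aestronglyMeasurable.aemeasurable.restrict
  have hvol : volume (axisCube (0 : EuclideanSpace ℝ (Fin n)) 1) = 1 := by
    simp [volume_axisCube]
  have h := ENNReal.lintegral_mul_le_Lp_mul_Lq
    (volume.restrict (axisCube (0 : EuclideanSpace ℝ (Fin n)) 1)) hpq
    (f := fun x => ENNReal.ofReal (w x) ^ (1 / p)) (g := fun x => ENNReal.ofReal (w x) ^ (-(1 / p)))
    (by fun_prop) (by fun_prop)
  have h1 : ∫⁻ x in axisCube (0 : EuclideanSpace ℝ (Fin n)) 1,
      ((fun x => ENNReal.ofReal (w x) ^ (1 / p)) * fun x => ENNReal.ofReal (w x) ^ (-(1 / p))) x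
        = 1 := by
    rw [← hvol, ← setLIntegral_one]
    refine lintegral_congr_ae ?_
    filter_upwards [ae_restrict_of_ae hw.pos_ae] with x hx
    rw [Pi.mul_apply, ← ENNReal.rpow_add _ _ (by simpa using hx) ENNReal.ofReal_ne_top]
    simp
  have h2 : ∀ x, (ENNReal.ofReal (w x) ^ (1 / p)) ^ p = ENNReal.ofReal (w x) := fun x => by
    rw [← ENNReal.rpow_mul, one_div_mul_cancel hpq.pos.ne', ENNReal.rpow_one]
  have h3 : ∀ x, (ENNReal.ofReal (w x) ^ (-(1 / p))) ^ q = ENNReal.ofReal (w x) ^ (1 - q) := by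
    intro x
    rw [← ENNReal.rpow_mul]
    congr 1
    have := hpq.symm.sub_one_mul_conj
    have := hpq.pos.ne'
    field_simp
    linarith
  rw [h1] at h
  simp only [h2, h3] at h
  have h4 := ENNReal.rpow_le_rpow h hpq.pos.le
  rw [ENNReal.one_rpow, ENNReal.mul_rpow_of_nonneg _ _ hpq.pos.le, ← ENNReal.rpow_mul,
    one_div_mul_cancel hpq.pos.ne', ENNReal.rpow_one, ← ENNReal.rpow_mul] at h4
  have h5 : 1 / q * p = p - 1 := by
    have := hpq.sub_one_mul_conj
    have := hpq.symm.pos.ne'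
    field_simp
    linarith
  rw [h5] at h4
  refine h4.trans ?_
  unfold apConst
  refine le_iSup_of_le 0 (le_iSup_of_le 1 (le_iSup_of_le one_pos ?_))
  rw [setLAverage_eq, setLAverage_eq, hvol, div_one, div_one]

lemma ae_norm_pos (m : ℕ) : ∀ᵐ x : EuclideanSpace ℝ (Fin (m + 1)), 0 < ‖x‖ := by
  have h : ∀ᵐ x : EuclideanSpace ℝ (Fin (m + 1)), x ≠ 0 := by
    simp [ae_iff]
  filter_upwards [h] with x hx using norm_pos_iff.2 hx

lemma ofReal_rpow_rpow {r : ℝ} (hr : 0 < r) (a b : ℝ) :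
    ENNReal.ofReal (r ^ a) ^ b = ENNReal.ofReal (r ^ (a * b)) := by
  rw [ENNReal.ofReal_rpow_of_pos (by positivity), ← Real.rpow_mul hr.le]

lemma one_sub_conjExponent {p : ℝ} (hp : 1 < p) : 1 - p.conjExponent = -(1 / (p - 1)) := by
  have : p - 1 ≠ 0 := by linarith
  rw [Real.conjExponent]
  field_simp
  ring

/-- The `A_p` constant of the weight `|x| ^ ((n - δ) (p - 1))` is `O(δ ^ (1 - p))`. -/
lemma exists_apConst_growing_le (m : ℕ) {p : ℝ} (hp : 1 < p) :
    ∃ C : ℝ, 0 < C ∧ ∀ δ : ℝ, 0 < δ → δ ≤ 1 →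
      apConst p (fun x : EuclideanSpace ℝ (Fin (m + 1)) => ‖x‖ ^ ((m + 1 - δ) * (p - 1))) ≤
        ENNReal.ofReal (C * δ ^ (-(p - 1))) := by
  obtain ⟨C, hC, h⟩ := exists_setLAverage_norm_rpow_le m
  have hp1 : 0 < p - 1 := by linarith
  refine ⟨C ^ (p - 1), by positivity, fun δ hδ hδ1 => ?_⟩
  have hm : (0 : ℝ) ≤ m := by positivity
  unfold apConst
  refine iSup_le fun a => iSup_le fun l => iSup_le fun hl => ?_
  obtain ⟨M, hM, hle, havg⟩ := h δ hδ hδ1 a l hl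
  have h1 : ⨍⁻ x in axisCube a l, ENNReal.ofReal (‖x‖ ^ ((m + 1 - δ) * (p - 1))) ∂volume ≤
      ENNReal.ofReal (M ^ ((m + 1 - δ) * (p - 1))) := by
    refine setLAverage_le_of_forall_le (measurableSet_axisCube a l) fun x hx => ENNReal.ofReal_le_ofReal ?_
    exact Real.rpow_le_rpow (norm_nonneg _) (hle x hx) (mul_nonneg (by linarith) hp1.le)
  have h2 : ⨍⁻ x in axisCube a l,
      ENNReal.ofReal (‖x‖ ^ ((m + 1 - δ) * (p - 1))) ^ (1 - p.conjExponent) ∂volume =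
      ⨍⁻ x in axisCube a l, ENNReal.ofReal (‖x‖ ^ (δ - (m + 1))) ∂volume := by
    rw [setLAverage_eq, setLAverage_eq]
    congr 1
    refine lintegral_congr_ae ?_
    filter_upwards [ae_restrict_of_ae (ae_norm_pos m)] with x hx
    rw [one_sub_conjExponent hp, ofReal_rpow_rpow hx]
    congr 2
    field_simp
    ring
  rw [h2]
  refine (mul_le_mul' h1 (ENNReal.rpow_le_rpow havg hp1.le)).trans_eq ?_
  rw [ENNReal.ofReal_rpow_of_pos (by positivity), ← ENNReal.ofReal_mul (by positivity)]
  congr 1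
  rw [Real.mul_rpow (by positivity) (by positivity), ← Real.rpow_mul hM.le,
    Real.div_rpow hC.le hδ.le, mul_left_comm, ← Real.rpow_add hM, Real.rpow_neg hδ.le,
    show (m + 1 - δ) * (p - 1) + (δ - (m + 1)) * (p - 1) = 0 by ring, Real.rpow_zero]
  ring

/-- The `A_p` constant of the weight `|x| ^ (δ - n)` is `O(1 / δ)`. -/
lemma exists_apConst_singular_le (m : ℕ) {p : ℝ} (hp : 1 < p) :
    ∃ C : ℝ, 0 < C ∧ ∀ δ : ℝ, 0 < δ → δ ≤ 1 →
      apConst p (fun x : EuclideanSpace ℝ (Fin (m + 1)) => ‖x‖ ^ (δ - (m + 1))) ≤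
        ENNReal.ofReal (C * δ ^ (-1 : ℝ)) := by
  obtain ⟨C, hC, h⟩ := exists_setLAverage_norm_rpow_le m
  have hp1 : 0 < p - 1 := by linarith
  refine ⟨C, hC, fun δ hδ hδ1 => ?_⟩
  have hm : (0 : ℝ) ≤ m := by positivity
  unfold apConst
  refine iSup_le fun a => iSup_le fun l => iSup_le fun hl => ?_
  obtain ⟨M, hM, hle, havg⟩ := h δ hδ hδ1 a l hl
  have h1 : ⨍⁻ x in axisCube a l,
      ENNReal.ofReal (‖x‖ ^ (δ - (m + 1))) ^ (1 - p.conjExponent) ∂volume ≤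
      ENNReal.ofReal (M ^ ((m + 1 - δ) / (p - 1))) := by
    have h2 : ⨍⁻ x in axisCube a l,
        ENNReal.ofReal (‖x‖ ^ (δ - (m + 1))) ^ (1 - p.conjExponent) ∂volume =
        ⨍⁻ x in axisCube a l, ENNReal.ofReal (‖x‖ ^ ((m + 1 - δ) / (p - 1))) ∂volume := by
      rw [setLAverage_eq, setLAverage_eq]
      congr 1
      refine lintegral_congr_ae ?_
      filter_upwards [ae_restrict_of_ae (ae_norm_pos m)] with x hx
      rw [one_sub_conjExponent hp, ofReal_rpow_rpow hx]
      congr 2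
      ring
    rw [h2]
    refine setLAverage_le_of_forall_le (measurableSet_axisCube a l) fun x hx => ENNReal.ofReal_le_ofReal ?_
    exact Real.rpow_le_rpow (norm_nonneg _) (hle x hx) (div_nonneg (by linarith) hp1.le)
  refine (mul_le_mul' havg (ENNReal.rpow_le_rpow h1 hp1.le)).trans_eq ?_
  rw [ofReal_rpow_rpow hM, ← ENNReal.ofReal_mul (by positivity)]
  congr 1
  rw [div_mul_cancel₀ _ hp1.ne', mul_assoc, ← Real.rpow_add hM, Real.rpow_neg_one,
    show δ - (m + 1) + (m + 1 - δ) = 0 by ring, Real.rpow_zero]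
  ring

lemma isApWeight_growing (m : ℕ) {p : ℝ} (hp : 1 < p) {δ : ℝ} (hδ : 0 < δ) (hδ1 : δ ≤ 1) :
    IsApWeight p
      (fun x : EuclideanSpace ℝ (Fin (m + 1)) => ‖x‖ ^ ((m + 1 - δ) * (p - 1))) := by
  obtain ⟨C, -, hC⟩ := exists_apConst_growing_le m hp
  have hm : (0 : ℝ) ≤ m := by positivity
  refine ⟨fun x => by positivity, ?_, ?_, (hC δ hδ hδ1).trans_lt ENNReal.ofReal_lt_top⟩
  · filter_upwards [ae_norm_pos m] with x hx using by positivity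
  · refine Continuous.locallyIntegrable ?_
    exact continuous_norm.rpow_const fun _ => Or.inr (mul_nonneg (by linarith) (by linarith))

lemma isApWeight_singular (m : ℕ) {p : ℝ} (hp : 1 < p) {δ : ℝ} (hδ : 0 < δ) (hδ1 : δ ≤ 1) :
    IsApWeight p (fun x : EuclideanSpace ℝ (Fin (m + 1)) => ‖x‖ ^ (δ - (m + 1))) := by
  obtain ⟨C, -, hC⟩ := exists_apConst_singular_le m hp
  refine ⟨fun x => by positivity, ?_, ?_, (hC δ hδ hδ1).trans_lt ENNReal.ofReal_lt_top⟩
  · filter_upwards [ae_norm_pos m] with x hx using by positivity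
  · intro x
    refine ⟨Metric.ball 0 (‖x‖ + 1), Metric.isOpen_ball.mem_nhds (by simp), ?_, ?_⟩
    · exact (measurable_norm.pow_const _).aestronglyMeasurable
    · rw [hasFiniteIntegral_iff_ofReal (.of_forall fun x => by positivity),
        lintegral_ball_norm_rpow m hδ (by positivity)]
      exact ENNReal.ofReal_lt_top

/-! ### Test functions and weighted operator norms -/

lemma weightedNorm_eq {n : ℕ} {F : Type*} [ENorm F] {p : ℝ} (hp : 0 < p)
    {w : EuclideanSpace ℝ (Fin n) → ℝ} (hw : Measurable w) (g : EuclideanSpace ℝ (Fin n) → F) :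
    weightedNorm p w g = (∫⁻ x, ENNReal.ofReal (w x) * ‖g x‖ₑ ^ p) ^ (1 / p) := by
  rw [weightedNorm, eLpNorm_eq_lintegral_rpow_enorm_toReal (by simpa using hp) ENNReal.ofReal_ne_top,
    ENNReal.toReal_ofReal hp.le,
    lintegral_withDensity_eq_lintegral_mul_non_measurable _ (by fun_prop) (by simp)]
  rfl

lemma ofReal_le_weightedOpNorm {n : ℕ} {p : ℝ} (hp : 0 < p)
    {w : EuclideanSpace ℝ (Fin n) → ℝ} (hw : Measurable w)
    {T : (EuclideanSpace ℝ (Fin n) → ℂ) → EuclideanSpace ℝ (Fin n) → ℂ} (hT : T 0 = 0)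
    (f : 𝓢(EuclideanSpace ℝ (Fin n), ℂ)) {X Z : ℝ} (hX : 0 < X) (hZ : 0 < Z)
    (hfX : ∫⁻ x, ENNReal.ofReal (w x) * ‖f x‖ₑ ^ p ≤ ENNReal.ofReal X)
    (hTf : ENNReal.ofReal (Z ^ p * X) ≤ ∫⁻ x, ENNReal.ofReal (w x) * ‖T f x‖ₑ ^ p) :
    ENNReal.ofReal Z ≤ weightedOpNorm p w T := by
  have hf0 : f ≠ 0 := by
    rintro rfl
    have h0 : T ((0 : 𝓢(EuclideanSpace ℝ (Fin n), ℂ)) : EuclideanSpace ℝ (Fin n) → ℂ) = 0 := by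
      rw [← hT]
      rfl
    rw [h0] at hTf
    simp only [Pi.zero_apply, enorm_zero, ENNReal.zero_rpow_of_pos hp, mul_zero, lintegral_zero,
      nonpos_iff_eq_zero, ENNReal.ofReal_eq_zero] at hTf
    have : 0 < Z ^ p * X := by positivity
    linarith
  unfold weightedOpNorm
  refine le_iSup₂_of_le f hf0 ?_
  have h1 : weightedNorm p w f ≤ ENNReal.ofReal X ^ (1 / p) := by
    rw [weightedNorm_eq hp hw]
    gcongr
  have h2 : ENNReal.ofReal Z * ENNReal.ofReal X ^ (1 / p) ≤ weightedNorm p w (T f) := by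
    rw [weightedNorm_eq hp hw]
    refine le_trans (le_of_eq ?_) (ENNReal.rpow_le_rpow hTf (by positivity))
    rw [ENNReal.ofReal_mul (by positivity), ENNReal.mul_rpow_of_nonneg _ _ (by positivity),
      ← ENNReal.ofReal_rpow_of_pos hZ, ← ENNReal.rpow_mul, mul_one_div_cancel hp.ne',
      ENNReal.rpow_one]
  calc ENNReal.ofReal Z = ENNReal.ofReal Z * ENNReal.ofReal X ^ (1 / p) /
        ENNReal.ofReal X ^ (1 / p) := by
        have hX' : ENNReal.ofReal X ≠ 0 := by simpa using hX
        rw [ENNReal.mul_div_cancel_right]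
        · simp [hX]
        · exact ENNReal.rpow_ne_top_of_nonneg (by positivity) ENNReal.ofReal_ne_top
    _ ≤ _ := by gcongr

lemma bochnerRiesz_zero {n : ℕ} (lam R : ℝ) :
    bochnerRiesz lam R (0 : EuclideanSpace ℝ (Fin n) → ℂ) = 0 := by
  ext x
  have h : 𝓕 (0 : EuclideanSpace ℝ (Fin n) → ℂ) = 0 := by
    ext ξ
    simp [Real.fourier_eq]
  simp [bochnerRiesz, h]

/-- A smooth radial profile on `(0, ∞)` times a smooth cutoff `θ` to an annulus is a Schwartz
function. -/
lemma exists_schwartz_annulus {E : Type*} [NormedAddCommGroup E] [InnerProductSpace ℝ E]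
    [FiniteDimensional ℝ E] {g : ℝ → ℂ} (hg : ContDiffOn ℝ (⊤ : ℕ∞) g (Set.Ioi 0)) {a b : ℝ} (ha : 0 < a)
    (hb : 0 < b) :
    ∃ (f : 𝓢(E, ℂ)) (θ : E → ℝ), HasCompactSupport f ∧
      (∀ y, f y = θ y * g ‖y‖) ∧ (∀ y, 0 ≤ θ y) ∧ (∀ y, θ y ≤ 1) ∧
      (∀ y, a ≤ ‖y‖ → ‖y‖ ≤ b → θ y = 1) ∧ (∀ y, ‖y‖ ≤ a / 2 → θ y = 0) ∧
      (∀ y, 2 * b ≤ ‖y‖ → θ y = 0) := by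
  let χ : ContDiffBump (0 : E) := ⟨b, 2 * b, hb, by linarith⟩
  let χ' : ContDiffBump (0 : E) := ⟨a / 2, a, by linarith, by linarith⟩
  set θ : E → ℝ := fun y => χ y * (1 - χ' y) with hθ
  have hθs : ContDiff ℝ (⊤ : ℕ∞) θ := χ.contDiff.mul (contDiff_const.sub χ'.contDiff)
  have h0 : ∀ y, ‖y‖ ≤ a / 2 → θ y = 0 := fun y hy => by
    simp [hθ, χ'.one_of_mem_closedBall (x := y) (by simpa using hy)]
  have h2 : ∀ y, 2 * b ≤ ‖y‖ → θ y = 0 := fun y hy => by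
    simp [hθ, χ.zero_of_le_dist (x := y) (by simpa using hy)]
  have hsm : ContDiff ℝ (⊤ : ℕ∞) fun y : E => (θ y : ℂ) * g ‖y‖ := by
    rw [contDiff_iff_contDiffAt]
    intro y
    by_cases hy : y = 0
    · have : (fun y : E => (θ y : ℂ) * g ‖y‖) =ᶠ[nhds y] fun _ => 0 := by
        rw [hy]
        filter_upwards [Metric.ball_mem_nhds (0 : E) (half_pos ha)] with z hz
        rw [h0 z (by simpa using (Metric.mem_ball.1 hz).le)]
        simp
      exact contDiffAt_const.congr_of_eventuallyEq this
    · refine (Complex.ofRealCLM.contDiff.contDiffAt.comp y hθs.contDiffAt).mul ?_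
      exact (hg.contDiffAt (Ioi_mem_nhds (norm_pos_iff.2 hy))).comp y (contDiffAt_norm ℝ hy)
  have hcs : HasCompactSupport fun y : E => (θ y : ℂ) * g ‖y‖ := by
    refine HasCompactSupport.intro (isCompact_closedBall (0 : E) (2 * b)) fun y hy => ?_
    rw [h2 y (by simpa using (not_le.1 (by simpa using hy)).le)]
    simp
  refine ⟨hcs.toSchwartzMap hsm, θ, hcs, fun y => rfl, fun y => ?_, fun y => ?_,
    fun y hy hy' => ?_, h0, h2⟩
  · exact mul_nonneg χ.nonneg (sub_nonneg.2 χ'.le_one)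
  · exact mul_le_one₀ χ.le_one (sub_nonneg.2 χ'.le_one) (by linarith [χ'.nonneg (x := y)])
  · simp [hθ, χ.one_of_mem_closedBall (x := y) (by simpa using hy'),
      χ'.zero_of_le_dist (x := y) (by simpa using hy)]

lemma integrable_brKernel_mul {n : ℕ} {lam : ℝ} (hlam : 0 < lam)
    {f : 𝓢(EuclideanSpace ℝ (Fin n), ℂ)} (hf : HasCompactSupport f)
    (x : EuclideanSpace ℝ (Fin n)) : Integrable fun y => brKernel lam (x - y) * f y :=
  (((continuous_brKernel hlam).comp (by fun_prop)).mul f.continuous).integrable_of_hasCompactSupport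
    hf.mul_left

lemma measurableSet_le_norm_oscProfile (A B : ℂ) :
    MeasurableSet {r : ℝ | ‖A‖ ≤ ‖oscProfile A B r‖} :=
  measurableSet_le measurable_const (continuous_oscProfile A B).norm.measurable

/-! ### Lower bounds for the weighted operator norm -/

lemma ofReal_mul_enorm_rpow {E : Type*} [SeminormedAddGroup E] {p u : ℝ} (hp : 0 ≤ p) (hu : 0 ≤ u)
    (z : E) :
    ENNReal.ofReal u * ‖z‖ₑ ^ p = ENNReal.ofReal (u * ‖z‖ ^ p) := by
  rw [← ofReal_norm, ENNReal.ofReal_rpow_of_nonneg (norm_nonneg _) hp, ← ENNReal.ofReal_mul hu]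

/-- Lower bound for the weight `|x| ^ ((n - δ) (p - 1))`. A truncation of `|y| ^ (δ - n)` to a small
ball has mass of order `1 / δ` and `p`-th power norm of order `1 / δ`; its image is of order
`|x| ^ (-n) / δ` on a large part of the complement of a ball. -/
lemma exists_le_weightedOpNorm_growing (m : ℕ) (hm : 0 < m) {p : ℝ} (hp : 1 < p) :
    ∃ c δ₀ : ℝ, 0 < c ∧ 0 < δ₀ ∧ δ₀ ≤ 1 ∧ ∀ δ : ℝ, 0 < δ → δ ≤ δ₀ →
      ENNReal.ofReal (c / δ) ≤ weightedOpNorm p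
        (fun x : EuclideanSpace ℝ (Fin (m + 1)) => ‖x‖ ^ ((m + 1 - δ) * (p - 1)))
        (bochnerRiesz ((m : ℝ) / 2) 1) := by
  obtain ⟨A, B, hA, hAB⟩ := exists_brKernel_approx m hm
  have hA' : 0 < ‖A‖ := norm_pos_iff.2 hA
  obtain ⟨ρ, R, hρ, hρ1, hR, hK⟩ := hAB (‖A‖ / 2) (by positivity)
  have hσ := sphereArea_pos m
  have hp0 : 0 < p := by linarith
  have hp1 : 0 < p - 1 := by linarith
  have hR0 : 0 < R := by linarith
  have hm' : (0 : ℝ) < (m : ℝ) / 2 := by positivity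
  set σ := sphereArea m with hσd
  set b := ρ / 2 with hb
  have hb0 : 0 < b := by positivity
  set k : ℝ := σ * b / 2 with hk
  refine ⟨‖A‖ / 2 * k * (1 / (10 * R * (p - 1))) ^ (1 / p), min 1 (1 / (p - 1)), by positivity,
    lt_min one_pos (by positivity), min_le_left _ _, fun δ hδ hδ0 => ?_⟩
  have hδ1 : δ ≤ 1 := hδ0.trans (min_le_left _ _)
  have hδp : δ * (p - 1) ≤ 1 := by
    rw [← le_div_iff₀ hp1]
    exact hδ0.trans (min_le_right _ _)
  -- Half of the mass of `|y| ^ (δ - n)` over the ball of radius `b` lies outside that of radius `a`.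
  set a : ℝ := b * 2 ^ (-(1 / δ)) with ha
  have ha0 : 0 < a := by positivity
  have hab : a ≤ b := mul_le_of_le_one_right hb0.le
    (Real.rpow_le_one_of_one_le_of_nonpos (by norm_num) (by simpa using hδ.le))
  have haδ : a ^ δ = b ^ δ / 2 := by
    rw [ha, Real.mul_rpow hb0.le (by positivity), ← Real.rpow_mul (by norm_num)]
    have : -(1 / δ) * δ = -1 := by field_simp
    rw [this, Real.rpow_neg_one]
    ring
  have hg : ContDiffOn ℝ (⊤ : ℕ∞) (fun r : ℝ => ((r ^ (δ - (m + 1)) : ℝ) : ℂ)) (Set.Ioi 0) :=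
    Complex.ofRealCLM.contDiff.comp_contDiffOn
      (contDiffOn_id.rpow_const_of_ne fun r hr => (ne_of_gt hr : r ≠ 0))
  obtain ⟨f, θ, hfc, hf, hθ0, hθ1, hθe, hθa, hθb⟩ :=
    exists_schwartz_annulus (E := EuclideanSpace ℝ (Fin (m + 1))) hg ha0 hb0
  have hfn : ∀ y, ‖f y‖ = θ y * ‖y‖ ^ (δ - (m + 1)) := fun y => by
    rw [hf, norm_mul, Complex.norm_real, Complex.norm_real, Real.norm_of_nonneg (hθ0 y),
      Real.norm_of_nonneg (by positivity)]
  have hf0 : ∀ y, ρ ≤ ‖y‖ → f y = 0 := fun y hy => by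
    rw [hf, hθb y (by rw [hb]; linarith)]
    simp
  have hfr : ∀ y, f y = (‖f y‖ : ℂ) := fun y => by
    rw [hfn, hf]
    push_cast
    rfl
  set M : ℝ := ∫ y, ‖f y‖ with hM
  have hfM : ∫ y, f y = (M : ℂ) := by
    rw [hM, ← integral_complex_ofReal]
    exact integral_congr_ae (.of_forall hfr)
  have hMk : k / δ ≤ M := by
    have hM0 : 0 ≤ M := integral_nonneg fun y => norm_nonneg _
    rw [← ENNReal.ofReal_le_ofReal_iff hM0, hM,
      ofReal_integral_eq_lintegral_ofReal f.integrable.norm (.of_forall fun y => norm_nonneg _)]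
    calc ENNReal.ofReal (k / δ) ≤ ENNReal.ofReal σ * ENNReal.ofReal ((b ^ δ - a ^ δ) / δ) := by
          rw [← ENNReal.ofReal_mul hσ.le]
          apply ENNReal.ofReal_le_ofReal
          have hbδ : b ≤ b ^ δ := by
            nth_rw 1 [← Real.rpow_one b]
            exact Real.rpow_le_rpow_of_exponent_ge hb0 (by linarith) hδ1
          rw [haδ, mul_div_assoc']
          gcongr
          rw [hk]
          nlinarith
      _ = ∫⁻ y in {y : EuclideanSpace ℝ (Fin (m + 1)) | ‖y‖ ∈ Set.Ioo a b},
            ENNReal.ofReal (‖y‖ ^ (δ - (m + 1))) := by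
          rw [setLIntegral_norm_rpow m δ measurableSet_Ioo,
            Set.inter_eq_left.2 fun r (hr : r ∈ Set.Ioo a b) => Set.mem_Ioi.2 (ha0.trans hr.1),
            lintegral_Ioo_rpow_of_pos hδ.ne' ha0 hab]
      _ ≤ ∫⁻ y in {y : EuclideanSpace ℝ (Fin (m + 1)) | ‖y‖ ∈ Set.Ioo a b},
            ENNReal.ofReal ‖f y‖ := by
          refine setLIntegral_mono' (measurable_norm measurableSet_Ioo) fun y hy => ?_
          rw [hfn, hθe y hy.1.le hy.2.le, one_mul]
      _ ≤ _ := setLIntegral_le_lintegral _ _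
  have hMp : 0 < M := lt_of_lt_of_le (by positivity) hMk
  -- The kernel is almost constant over the support of `f`.
  have hTf : ∀ x, R < ‖x‖ → ‖A‖ ≤ ‖oscProfile A B ‖x‖‖ →
      ‖A‖ / 2 * M / ‖x‖ ^ (m + 1) ≤ ‖bochnerRiesz ((m : ℝ) / 2) 1 f x‖ := by
    intro x hx hG
    have hx0 : 0 < ‖x‖ := hR0.trans hx
    set L : ℂ := oscProfile A B ‖x‖ / (‖x‖ : ℂ) ^ (m + 1) with hL
    have hsub : bochnerRiesz ((m : ℝ) / 2) 1 f x - L * M =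
        ∫ y, (brKernel ((m : ℝ) / 2) (x - y) - L) * f y := by
      rw [bochnerRiesz_eq_integral_brKernel hm', ← hfM, ← integral_const_mul,
        ← integral_sub (integrable_brKernel_mul hm' hfc x) (f.integrable.const_mul L)]
      simp only [sub_mul]
    have hle : ‖bochnerRiesz ((m : ℝ) / 2) 1 f x - L * M‖ ≤ ‖A‖ / 2 / ‖x‖ ^ (m + 1) * M := by
      rw [hsub, hM, ← integral_const_mul]
      refine norm_integral_le_of_norm_le (f.integrable.norm.const_mul _) (.of_forall fun y => ?_)
      rw [norm_mul]
      rcases le_or_gt ρ ‖y‖ with hy | hy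
      · simp [hf0 y hy]
      · gcongr
        exact hK x y hx.le hy.le
    have hLn : ‖A‖ / ‖x‖ ^ (m + 1) * M ≤ ‖L * M‖ := by
      rw [norm_mul, hL, norm_div, norm_pow, Complex.norm_real, Complex.norm_real, norm_norm,
        Real.norm_of_nonneg hMp.le]
      gcongr
    have htri := norm_sub_norm_le (L * M) (L * M - bochnerRiesz ((m : ℝ) / 2) 1 f x)
    rw [sub_sub_cancel, norm_sub_rev (L * (M : ℂ))] at htri
    have : ‖A‖ / ‖x‖ ^ (m + 1) * M - ‖A‖ / 2 / ‖x‖ ^ (m + 1) * M =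
        ‖A‖ / 2 * M / ‖x‖ ^ (m + 1) := by
      field_simp
      ring
    linarith
  refine ofReal_le_weightedOpNorm hp0 (measurable_norm.pow_const _) (bochnerRiesz_zero _ _) f
    (X := σ / δ) (by positivity) (by positivity) ?_ ?_
  · calc ∫⁻ x, ENNReal.ofReal (‖x‖ ^ ((m + 1 - δ) * (p - 1))) * ‖f x‖ₑ ^ p
        ≤ ∫⁻ x, (Metric.ball (0 : EuclideanSpace ℝ (Fin (m + 1))) ρ).indicator
            (fun x => ENNReal.ofReal (‖x‖ ^ (δ - (m + 1)))) x := by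
          refine lintegral_mono fun x => ?_
          by_cases hx : x ∈ Metric.ball (0 : EuclideanSpace ℝ (Fin (m + 1))) ρ
          · rw [Set.indicator_of_mem hx, ofReal_mul_enorm_rpow hp0.le (by positivity), hfn]
            apply ENNReal.ofReal_le_ofReal
            rcases eq_or_lt_of_le (norm_nonneg x) with hx0 | hx0
            · rw [hθa x (by rw [← hx0]; positivity), zero_mul, Real.zero_rpow hp0.ne', mul_zero]
              positivity
            · calc ‖x‖ ^ ((m + 1 - δ) * (p - 1)) * (θ x * ‖x‖ ^ (δ - (m + 1))) ^ p
                  ≤ ‖x‖ ^ ((m + 1 - δ) * (p - 1)) * (‖x‖ ^ (δ - (m + 1))) ^ p := by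
                    gcongr
                    · exact mul_nonneg (hθ0 x) (by positivity)
                    · exact mul_le_of_le_one_left (by positivity) (hθ1 x)
                _ = ‖x‖ ^ (δ - (m + 1)) := by
                    rw [← Real.rpow_mul hx0.le, ← Real.rpow_add hx0]
                    congr 1
                    ring
          · rw [hf0 x (by simpa using hx)]
            simp [hp0]
      _ = ENNReal.ofReal (σ * (ρ ^ δ / δ)) := by
          rw [lintegral_indicator measurableSet_ball, lintegral_ball_norm_rpow m hδ hρ.le]
      _ ≤ _ := by
          apply ENNReal.ofReal_le_ofReal
          rw [mul_div_assoc']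
          gcongr
          exact mul_le_of_le_one_right hσ.le (Real.rpow_le_one hρ.le hρ1 hδ.le)
  · obtain ⟨N, -, hN⟩ := exists_le_lintegral_norm_rpow_neg m
      (measurableSet_le_norm_oscProfile A B) (norm_le_oscProfile_or A B)
      (δ := δ * (p - 1)) (by positivity) hδp hR
    have hconst : (‖A‖ / 2 * k * (1 / (10 * R * (p - 1))) ^ (1 / p) / δ) ^ p * (σ / δ) ≤
        (‖A‖ / 2 * M) ^ p * (σ * (R ^ (-(δ * (p - 1))) / (10 * (δ * (p - 1))))) := by
      have h1 : ‖A‖ / 2 * k * (1 / (10 * R * (p - 1))) ^ (1 / p) / δ =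
          ‖A‖ / 2 * (k / δ) * (1 / (10 * R * (p - 1))) ^ (1 / p) := by ring
      rw [h1, Real.mul_rpow (by positivity) (by positivity), ← Real.rpow_mul (by positivity),
        one_div_mul_cancel hp0.ne', Real.rpow_one, mul_assoc]
      have h2 : R⁻¹ ≤ R ^ (-(δ * (p - 1))) := by
        rw [← Real.rpow_neg_one]
        exact Real.rpow_le_rpow_of_exponent_le hR (by linarith)
      have h3 : 1 / (10 * R * (p - 1)) * (σ / δ) = σ * (R⁻¹ / (10 * (δ * (p - 1)))) := by
        field_simp
      rw [h3]
      gcongr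
    calc _ ≤ ENNReal.ofReal ((‖A‖ / 2 * M) ^ p) *
          ENNReal.ofReal (σ * (R ^ (-(δ * (p - 1))) / (10 * (δ * (p - 1))))) := by
          rw [← ENNReal.ofReal_mul (by positivity)]
          exact ENNReal.ofReal_le_ofReal hconst
      _ ≤ ENNReal.ofReal ((‖A‖ / 2 * M) ^ p) * _ := mul_le_mul_right hN _
      _ = ∫⁻ x in {x : EuclideanSpace ℝ (Fin (m + 1)) |
            ‖x‖ ∈ {r | ‖A‖ ≤ ‖oscProfile A B r‖} ∩ Set.Ioo R N},
            ENNReal.ofReal ((‖A‖ / 2 * M) ^ p) *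
              ENNReal.ofReal (‖x‖ ^ (-(δ * (p - 1)) - (m + 1))) := by
          rw [lintegral_const_mul]
          exact (measurable_norm.pow_const _).ennreal_ofReal
      _ ≤ ∫⁻ x in {x : EuclideanSpace ℝ (Fin (m + 1)) |
            ‖x‖ ∈ {r | ‖A‖ ≤ ‖oscProfile A B r‖} ∩ Set.Ioo R N},
            ENNReal.ofReal (‖x‖ ^ ((m + 1 - δ) * (p - 1))) *
              ‖bochnerRiesz ((m : ℝ) / 2) 1 f x‖ₑ ^ p := by
          refine setLIntegral_mono' (measurable_norm
            ((measurableSet_le_norm_oscProfile A B).inter measurableSet_Ioo)) fun x hx => ?_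
          have hx0 : 0 < ‖x‖ := hR0.trans hx.2.1
          rw [ofReal_mul_enorm_rpow hp0.le (by positivity), ← ENNReal.ofReal_mul (by positivity)]
          apply ENNReal.ofReal_le_ofReal
          calc _ = ‖x‖ ^ ((m + 1 - δ) * (p - 1)) * (‖A‖ / 2 * M / ‖x‖ ^ (m + 1)) ^ p := by
                rw [Real.div_rpow (by positivity) (by positivity), ← Real.rpow_natCast,
                  ← Real.rpow_mul hx0.le, div_eq_mul_inv ((‖A‖ / 2 * M) ^ p), ← Real.rpow_neg hx0.le, mul_left_comm,
                  ← Real.rpow_add hx0]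
                congr 2
                push_cast
                ring
            _ ≤ _ := by
                gcongr
                exact hTf x hx.2.1 hx.1
      _ ≤ _ := setLIntegral_le_lintegral _ _

/-- Lower bound for the weight `|x| ^ (δ - n)`. The test function is `|y| ^ (-δ)` times the conjugate
of the oscillating profile of the kernel, so that its image near the origin is an integral without
cancellation, of order `1 / δ`. -/
lemma exists_le_weightedOpNorm_singular (m : ℕ) (hm : 0 < m) {p : ℝ} (hp : 1 < p) :
    ∃ c δ₀ : ℝ, 0 < c ∧ 0 < δ₀ ∧ δ₀ ≤ 1 ∧ ∀ δ : ℝ, 0 < δ → δ ≤ δ₀ →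
      ENNReal.ofReal (c / δ) ≤ weightedOpNorm p
        (fun x : EuclideanSpace ℝ (Fin (m + 1)) => ‖x‖ ^ (δ - (m + 1)))
        (bochnerRiesz ((m : ℝ) / 2) 1) := by
  obtain ⟨A, B, hA, hAB⟩ := exists_brKernel_approx m hm
  have hA' : 0 < ‖A‖ := norm_pos_iff.2 hA
  set M := ‖A‖ + ‖B‖ with hM
  have hMp : 0 < M := by positivity
  -- The main term is at least `‖A‖ ^ 2 σ / (20 δ)`, and this precision makes the error at most half
  -- of it.
  obtain ⟨ρ, R, hρ, hρ1, hR, hK⟩ := hAB (‖A‖ ^ 2 / (40 * M)) (by positivity)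
  have hσ := sphereArea_pos m
  have hp0 : 0 < p := by linarith
  have hp1 : 0 < p - 1 := by linarith
  have hR0 : 0 < R := by linarith
  have hm' : (0 : ℝ) < (m : ℝ) / 2 := by positivity
  set σ := sphereArea m with hσd
  refine ⟨‖A‖ ^ 2 * σ / 40 * (ρ * (p - 1) / M ^ p) ^ (1 / p), 1 / (2 * R), by positivity,
    by positivity, by rw [div_le_one (by positivity)]; linarith, fun δ hδ hδ0 => ?_⟩
  have hδR : δ * (2 * R) ≤ 1 := by rwa [← le_div_iff₀ (by positivity)]
  have hδ1 : δ ≤ 1 := by nlinarith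
  -- For small `δ` the factor `(2 R) ^ (-δ)` is bounded below, independently of `R`.
  have hRδ : 1 / 2 ≤ (2 * R) ^ (-δ) := by
    have h1 := rpow_one_add_le_one_add_mul_self (s := 2 * R - 1) (by linarith) hδ.le hδ1
    rw [add_sub_cancel] at h1
    rw [Real.rpow_neg (by positivity), ← one_div]
    exact one_div_le_one_div_of_le (by positivity) (by nlinarith)
  obtain ⟨N, hRN, hN⟩ := exists_le_lintegral_norm_rpow_neg m
    (measurableSet_le_norm_oscProfile A B) (norm_le_oscProfile_or A B) hδ hδ1
    (R := 2 * R) (by linarith)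
  have hN0 : 0 < N := by linarith
  have hg : ContDiffOn ℝ (⊤ : ℕ∞)
      (fun r : ℝ => (starRingEnd ℂ) (oscProfile A B r) * ((r ^ (-δ) : ℝ) : ℂ)) (Set.Ioi 0) := by
    refine ContDiffOn.mul ?_ ?_
    · exact (Complex.conjCLE.contDiff.comp (contDiff_oscProfile A B)).contDiffOn
    · exact Complex.ofRealCLM.contDiff.comp_contDiffOn
        (contDiffOn_id.rpow_const_of_ne fun r hr => (ne_of_gt hr : r ≠ 0))
  obtain ⟨f, θ, hfc, hf, hθ0, hθ1, hθe, hθa, -⟩ :=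
    exists_schwartz_annulus (E := EuclideanSpace ℝ (Fin (m + 1))) hg (a := 2 * R) (b := N)
      (by positivity) hN0
  have hfn : ∀ y, ‖f y‖ ≤ M * ‖y‖ ^ (-δ) := fun y => by
    rw [hf, norm_mul, norm_mul, Complex.norm_real, Complex.norm_real, Real.norm_of_nonneg (hθ0 y),
      Real.norm_of_nonneg (r := ‖y‖ ^ (-δ)) (by positivity), RCLike.norm_conj]
    refine (mul_le_of_le_one_left (by positivity) (hθ1 y)).trans ?_
    gcongr
    exact norm_oscProfile_le A B _
  have hf0 : ∀ y, ‖y‖ ≤ R → f y = 0 := fun y hy => by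
    rw [hf, hθa y (by linarith)]
    simp
  -- The leading term of `B f` near the origin is the integral of the non-negative function `h`.
  set L : EuclideanSpace ℝ (Fin (m + 1)) → ℂ := fun y =>
    oscProfile A B ‖y‖ / (‖y‖ : ℂ) ^ (m + 1) with hL
  set h : EuclideanSpace ℝ (Fin (m + 1)) → ℝ := fun y =>
    θ y * ‖oscProfile A B ‖y‖‖ ^ 2 * ‖y‖ ^ (-δ - (m + 1)) with hh
  have hh0 : ∀ y, 0 ≤ h y := fun y =>
    mul_nonneg (mul_nonneg (hθ0 y) (sq_nonneg _)) (by positivity)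
  have hLf : ∀ y, L y * f y = (h y : ℂ) := by
    intro y
    rcases le_or_gt ‖y‖ R with hy | hy
    · simp [hf0 y hy, hh, hθa y (by linarith)]
    have hy0 : 0 < ‖y‖ := hR0.trans hy
    have h1 : ‖y‖ ^ (-δ - (m + 1)) = ‖y‖ ^ (-δ) / ‖y‖ ^ (m + 1) := by
      rw [Real.rpow_sub hy0, ← Real.rpow_natCast]
      push_cast
      rfl
    rw [hf, hL, hh]
    simp only [h1]
    push_cast
    rw [← Complex.mul_conj']
    ring
  have hLm : Measurable L :=
    ((continuous_oscProfile A B).measurable.comp measurable_norm).div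
      ((Complex.measurable_ofReal.comp measurable_norm).pow_const _)
  have hLi : Integrable fun y => L y * f y := by
    refine (f.integrable.norm.const_mul (M / R ^ (m + 1))).mono'
      (hLm.aestronglyMeasurable.mul f.continuous.aestronglyMeasurable) (.of_forall fun y => ?_)
    rcases le_or_gt ‖y‖ R with hy | hy
    · simp [hf0 y hy]
    rw [norm_mul, hL, norm_div, norm_pow, Complex.norm_real, norm_norm]
    gcongr
    exact norm_oscProfile_le A B _
  have hhi : Integrable h := by
    have := hLi.norm
    refine this.congr (.of_forall fun y => ?_)
    simp only [hLf, Complex.norm_real, Real.norm_of_nonneg (hh0 y)]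
  have hmain : ‖A‖ ^ 2 * σ / (20 * δ) ≤ ∫ y, h y := by
    rw [← ENNReal.ofReal_le_ofReal_iff (integral_nonneg hh0),
      ofReal_integral_eq_lintegral_ofReal hhi (.of_forall hh0)]
    calc ENNReal.ofReal (‖A‖ ^ 2 * σ / (20 * δ))
        ≤ ENNReal.ofReal (‖A‖ ^ 2) *
          ENNReal.ofReal (σ * ((2 * R) ^ (-δ) / (10 * δ))) := by
          rw [← ENNReal.ofReal_mul (by positivity)]
          apply ENNReal.ofReal_le_ofReal
          calc ‖A‖ ^ 2 * σ / (20 * δ) = ‖A‖ ^ 2 * (σ * ((1 / 2) / (10 * δ))) := by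
                field_simp
                norm_num
            _ ≤ _ := by gcongr
      _ ≤ ENNReal.ofReal (‖A‖ ^ 2) * _ := mul_le_mul_right hN _
      _ = ∫⁻ x in {x : EuclideanSpace ℝ (Fin (m + 1)) |
            ‖x‖ ∈ {r | ‖A‖ ≤ ‖oscProfile A B r‖} ∩ Set.Ioo (2 * R) N},
            ENNReal.ofReal (‖A‖ ^ 2) * ENNReal.ofReal (‖x‖ ^ (-δ - (m + 1))) := by
          rw [lintegral_const_mul]
          exact (measurable_norm.pow_const _).ennreal_ofReal
      _ ≤ ∫⁻ x in {x : EuclideanSpace ℝ (Fin (m + 1)) |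
            ‖x‖ ∈ {r | ‖A‖ ≤ ‖oscProfile A B r‖} ∩ Set.Ioo (2 * R) N}, ENNReal.ofReal (h x) := by
          refine setLIntegral_mono' (measurable_norm
            ((measurableSet_le_norm_oscProfile A B).inter measurableSet_Ioo)) fun x hx => ?_
          rw [← ENNReal.ofReal_mul (by positivity)]
          apply ENNReal.ofReal_le_ofReal
          simp only [hh]
          rw [hθe x hx.2.1.le hx.2.2.le, one_mul]
          have := hx.1
          gcongr
          exact this
      _ ≤ _ := setLIntegral_le_lintegral _ _
  have hTf : ∀ x, ‖x‖ < ρ →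
      ‖A‖ ^ 2 * σ / (40 * δ) ≤ ‖bochnerRiesz ((m : ℝ) / 2) 1 f x‖ := by
    intro x hx
    set I : ℝ := ∫ y, h y with hI
    have hII : ∫ y, L y * f y = (I : ℂ) := by
      rw [hI, ← integral_complex_ofReal]
      exact integral_congr_ae (.of_forall hLf)
    have hsub : bochnerRiesz ((m : ℝ) / 2) 1 f x - I =
        ∫ y, (brKernel ((m : ℝ) / 2) (x - y) - L y) * f y := by
      rw [bochnerRiesz_eq_integral_brKernel hm', ← hII,
        ← integral_sub (integrable_brKernel_mul hm' hfc x) hLi]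
      simp only [sub_mul]
    have hle : ‖bochnerRiesz ((m : ℝ) / 2) 1 f x - I‖ ≤ ‖A‖ ^ 2 * σ / (40 * δ) := by
      have hd : 0 ≤ ‖A‖ ^ 2 * σ / (40 * δ) := by positivity
      rw [hsub, ← ENNReal.ofReal_le_ofReal_iff hd, ofReal_norm]
      refine (enorm_integral_le_lintegral_enorm _).trans ?_
      calc ∫⁻ y, ‖(brKernel ((m : ℝ) / 2) (x - y) - L y) * f y‖ₑ
          ≤ ∫⁻ y, {y : EuclideanSpace ℝ (Fin (m + 1)) | R < ‖y‖}.indicator (fun y =>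
              ENNReal.ofReal (‖A‖ ^ 2 / 40) * ENNReal.ofReal (‖y‖ ^ (-δ - (m + 1)))) y := by
            refine lintegral_mono fun y => ?_
            rcases le_or_gt ‖y‖ R with hy | hy
            · simp [hf0 y hy]
            rw [Set.indicator_of_mem (show y ∈ {y | R < ‖y‖} from hy), ← ofReal_norm,
              ← ENNReal.ofReal_mul (by positivity)]
            apply ENNReal.ofReal_le_ofReal
            have hy0 : 0 < ‖y‖ := hR0.trans hy
            rw [norm_mul, brKernel_eq_of_norm_eq _ (norm_sub_rev x y)]
            calc _ ≤ ‖A‖ ^ 2 / (40 * M) / ‖y‖ ^ (m + 1) * (M * ‖y‖ ^ (-δ)) := by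
                  gcongr
                  · exact hK y x hy.le hx.le
                  · exact hfn y
              _ = _ := by
                  rw [Real.rpow_sub hy0 (-δ), ← Nat.cast_succ, Real.rpow_natCast]
                  field_simp
        _ = ENNReal.ofReal (‖A‖ ^ 2 / 40) * ENNReal.ofReal (σ * (R ^ (-δ) / δ)) := by
            rw [lintegral_indicator (measurableSet_lt measurable_const measurable_norm), lintegral_const_mul,
              lintegral_norm_rpow_neg m hδ hR0]
            exact (measurable_norm.pow_const _).ennreal_ofReal
        _ ≤ _ := by
            rw [← ENNReal.ofReal_mul (by positivity)]
            apply ENNReal.ofReal_le_ofReal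
            calc ‖A‖ ^ 2 / 40 * (σ * (R ^ (-δ) / δ)) ≤ ‖A‖ ^ 2 / 40 * (σ * (1 / δ)) := by
                  gcongr
                  exact Real.rpow_le_one_of_one_le_of_nonpos hR (by linarith)
              _ = _ := by field_simp
    have htri := norm_sub_norm_le (I : ℂ) (I - bochnerRiesz ((m : ℝ) / 2) 1 f x)
    rw [sub_sub_cancel, norm_sub_rev (I : ℂ), Complex.norm_real,
      Real.norm_of_nonneg (integral_nonneg hh0)] at htri
    have : ‖A‖ ^ 2 * σ / (20 * δ) = 2 * (‖A‖ ^ 2 * σ / (40 * δ)) := by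
      field_simp
      norm_num
    linarith
  refine ofReal_le_weightedOpNorm hp0 (measurable_norm.pow_const _) (bochnerRiesz_zero _ _) f
    (X := M ^ p * σ / (δ * (p - 1))) (by positivity) (by positivity) ?_ ?_
  · calc ∫⁻ x, ENNReal.ofReal (‖x‖ ^ (δ - (m + 1))) * ‖f x‖ₑ ^ p
        ≤ ∫⁻ x, {x : EuclideanSpace ℝ (Fin (m + 1)) | R < ‖x‖}.indicator (fun x =>
            ENNReal.ofReal (M ^ p) * ENNReal.ofReal (‖x‖ ^ (-(δ * (p - 1)) - (m + 1)))) x := by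
          refine lintegral_mono fun x => ?_
          rcases le_or_gt ‖x‖ R with hx | hx
          · simp [hf0 x hx, hp0]
          have hx0 : 0 < ‖x‖ := hR0.trans hx
          rw [Set.indicator_of_mem (show x ∈ {x | R < ‖x‖} from hx),
            ofReal_mul_enorm_rpow hp0.le (by positivity), ← ENNReal.ofReal_mul (by positivity)]
          apply ENNReal.ofReal_le_ofReal
          calc _ ≤ ‖x‖ ^ (δ - (m + 1)) * (M * ‖x‖ ^ (-δ)) ^ p := by
                gcongr
                exact hfn x
            _ = _ := by
                rw [Real.mul_rpow hMp.le (by positivity), ← Real.rpow_mul hx0.le, mul_left_comm,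
                  ← Real.rpow_add hx0]
                congr 2
                ring
      _ = ENNReal.ofReal (M ^ p) *
          ENNReal.ofReal (σ * (R ^ (-(δ * (p - 1))) / (δ * (p - 1)))) := by
          rw [lintegral_indicator (measurableSet_lt measurable_const measurable_norm), lintegral_const_mul,
            lintegral_norm_rpow_neg m (by positivity) hR0]
          exact (measurable_norm.pow_const _).ennreal_ofReal
      _ ≤ _ := by
          rw [← ENNReal.ofReal_mul (by positivity)]
          apply ENNReal.ofReal_le_ofReal
          calc _ ≤ M ^ p * (σ * (1 / (δ * (p - 1)))) := by
                gcongr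
                refine Real.rpow_le_one_of_one_le_of_nonpos hR ?_
                have : 0 < δ * (p - 1) := by positivity
                linarith
            _ = _ := by ring
  · have hconst : (‖A‖ ^ 2 * σ / 40 * (ρ * (p - 1) / M ^ p) ^ (1 / p) / δ) ^ p *
        (M ^ p * σ / (δ * (p - 1))) ≤ (‖A‖ ^ 2 * σ / (40 * δ)) ^ p * (σ * (ρ ^ δ / δ)) := by
      have h1 : ‖A‖ ^ 2 * σ / 40 * (ρ * (p - 1) / M ^ p) ^ (1 / p) / δ =
          ‖A‖ ^ 2 * σ / (40 * δ) * (ρ * (p - 1) / M ^ p) ^ (1 / p) := by ring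
      rw [h1, Real.mul_rpow (by positivity) (by positivity),
        ← Real.rpow_mul (x := ρ * (p - 1) / M ^ p) (by positivity),
        one_div_mul_cancel hp0.ne', Real.rpow_one, mul_assoc]
      have h2 : ρ ≤ ρ ^ δ := by
        nth_rw 1 [← Real.rpow_one ρ]
        exact Real.rpow_le_rpow_of_exponent_ge hρ hρ1 hδ1
      have h3 : ρ * (p - 1) / M ^ p * (M ^ p * σ / (δ * (p - 1))) = σ * (ρ / δ) := by
        have : M ^ p ≠ 0 := by positivity
        field_simp
      rw [h3]
      gcongr
    calc _ ≤ ENNReal.ofReal ((‖A‖ ^ 2 * σ / (40 * δ)) ^ p) *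
          ENNReal.ofReal (σ * (ρ ^ δ / δ)) := by
          rw [← ENNReal.ofReal_mul (by positivity)]
          exact ENNReal.ofReal_le_ofReal hconst
      _ = ∫⁻ x in Metric.ball (0 : EuclideanSpace ℝ (Fin (m + 1))) ρ,
            ENNReal.ofReal ((‖A‖ ^ 2 * σ / (40 * δ)) ^ p) *
              ENNReal.ofReal (‖x‖ ^ (δ - (m + 1))) := by
          rw [lintegral_const_mul, lintegral_ball_norm_rpow m hδ hρ.le]
          exact (measurable_norm.pow_const _).ennreal_ofReal
      _ ≤ ∫⁻ x in Metric.ball (0 : EuclideanSpace ℝ (Fin (m + 1))) ρ,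
            ENNReal.ofReal (‖x‖ ^ (δ - (m + 1))) *
              ‖bochnerRiesz ((m : ℝ) / 2) 1 f x‖ₑ ^ p := by
          refine setLIntegral_mono' measurableSet_ball fun x hx => ?_
          rw [ofReal_mul_enorm_rpow hp0.le (by positivity), ← ENNReal.ofReal_mul (by positivity),
            mul_comm]
          apply ENNReal.ofReal_le_ofReal
          gcongr
          exact hTf x (by simpa using hx)
      _ ≤ _ := setLIntegral_le_lintegral _ _

/-! ### The necessary condition on the exponent -/

/-- If operator norms of order at least `1 / δ` are bounded by the power `β` of quantities of order
at most `δ ^ (-s)`, then `1 / s ≤ β`. -/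
lemma one_div_le_of_forall_le {s c C K δ₀ β : ℝ} (hs : 0 < s) (hc : 0 < c) (hC : 0 < C)
    (hδ₀ : 0 < δ₀) (X : ℝ → ℝ≥0∞) (hX1 : ∀ δ, 0 < δ → δ ≤ δ₀ → 1 ≤ X δ)
    (hX : ∀ δ, 0 < δ → δ ≤ δ₀ → X δ ≤ ENNReal.ofReal (C * δ ^ (-s)))
    (h : ∀ δ, 0 < δ → δ ≤ δ₀ → ENNReal.ofReal (c / δ) ≤ ENNReal.ofReal K * X δ ^ β) :
    1 / s ≤ β := by
  by_contra! hβ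
  -- Since `X δ ≥ 1`, a negative exponent may be replaced by `0`.
  set γ := max β 0 with hγ
  have hγ0 : 0 ≤ γ := le_max_right _ _
  have hsγ : 0 < 1 - s * γ := by
    have : γ < 1 / s := max_lt hβ (by positivity)
    rw [lt_div_iff₀ hs] at this
    linarith
  have key : ∀ δ, 0 < δ → δ ≤ δ₀ → c ≤ K * C ^ γ * δ ^ (1 - s * γ) := by
    intro δ hδ hδ'
    have h1 : X δ ^ β ≤ ENNReal.ofReal (C ^ γ * δ ^ (-s * γ)) := by
      refine (ENNReal.rpow_le_rpow_of_exponent_le (hX1 δ hδ hδ') (le_max_left β 0)).trans ?_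
      refine (ENNReal.rpow_le_rpow (hX δ hδ hδ') hγ0).trans_eq ?_
      rw [ENNReal.ofReal_rpow_of_nonneg (by positivity) hγ0, Real.mul_rpow hC.le (by positivity),
        ← Real.rpow_mul hδ.le]
    have h2 := (h δ hδ hδ').trans (mul_le_mul_right h1 _)
    rw [← ENNReal.ofReal_mul' (by positivity)] at h2
    have h3 : c / δ ≤ K * (C ^ γ * δ ^ (-s * γ)) := by
      rcases ENNReal.ofReal_le_ofReal_iff'.1 h2 with h3 | h3
      · exact h3
      · exact absurd h3 (not_le.2 (by positivity))
    rw [div_le_iff₀ hδ] at h3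
    refine h3.trans_eq ?_
    rw [sub_eq_add_neg, add_comm, Real.rpow_add hδ, Real.rpow_one, neg_mul]
    ring
  have hlim : Filter.Tendsto (fun δ : ℝ => K * C ^ γ * δ ^ (1 - s * γ)) (nhdsWithin 0 (Set.Ioi 0))
      (nhds 0) := by
    have h1 : ContinuousAt (fun δ : ℝ => K * C ^ γ * δ ^ (1 - s * γ)) 0 :=
      continuousAt_const.mul (Real.continuousAt_rpow_const _ _ (Or.inr hsγ.le))
    have h2 := h1.tendsto
    simp only [Real.zero_rpow hsγ.ne', mul_zero] at h2
    exact h2.mono_left nhdsWithin_le_nhds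
  have hev : ∀ᶠ δ : ℝ in nhdsWithin 0 (Set.Ioi 0), c ≤ K * C ^ γ * δ ^ (1 - s * γ) := by
    filter_upwards [Ioc_mem_nhdsGT hδ₀] with δ hδ using key δ hδ.1 hδ.2
  exact absurd (ge_of_tendsto hlim hev) (not_le.2 hc)

lemma max_le_of_weighted_bound (m : ℕ) (hm : 0 < m) {p : ℝ} (hp : 1 < p) {β K : ℝ}
    (h : ∀ w : EuclideanSpace ℝ (Fin (m + 1)) → ℝ, IsApWeight p w →
      weightedOpNorm p w (bochnerRiesz ((m : ℝ) / 2) 1) ≤ ENNReal.ofReal K * apConst p w ^ β) :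
    max 1 (1 / (p - 1)) ≤ β := by
  have hp1 : 0 < p - 1 := by linarith
  refine max_le ?_ ?_
  · obtain ⟨c, δ₀, hc, hδ₀, hδ₁, hlow⟩ := exists_le_weightedOpNorm_singular m hm hp
    obtain ⟨C, hC, hup⟩ := exists_apConst_singular_le m hp
    have := one_div_le_of_forall_le one_pos hc hC hδ₀ (K := K) (β := β)
      (fun δ => apConst p fun x : EuclideanSpace ℝ (Fin (m + 1)) => ‖x‖ ^ (δ - (m + 1)))
      (fun δ hδ hδ' => one_le_apConst hp (isApWeight_singular m hp hδ (hδ'.trans hδ₁)))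
      (fun δ hδ hδ' => hup δ hδ (hδ'.trans hδ₁))
      (fun δ hδ hδ' => (hlow δ hδ hδ').trans (h _ (isApWeight_singular m hp hδ (hδ'.trans hδ₁))))
    simpa using this
  · obtain ⟨c, δ₀, hc, hδ₀, hδ₁, hlow⟩ := exists_le_weightedOpNorm_growing m hm hp
    obtain ⟨C, hC, hup⟩ := exists_apConst_growing_le m hp
    exact one_div_le_of_forall_le hp1 hc hC hδ₀ (K := K) (β := β)
      (fun δ => apConst p fun x : EuclideanSpace ℝ (Fin (m + 1)) =>
        ‖x‖ ^ ((m + 1 - δ) * (p - 1)))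
      (fun δ hδ hδ' => one_le_apConst hp (isApWeight_growing m hp hδ (hδ'.trans hδ₁)))
      (fun δ hδ hδ' => hup δ hδ (hδ'.trans hδ₁))
      (fun δ hδ hδ' => (hlow δ hδ hδ').trans (h _ (isApWeight_growing m hp hδ (hδ'.trans hδ₁))))

lemma weightedOpNorm_bochnerRiesz_le_maximal {n : ℕ} (p lam : ℝ)
    (w : EuclideanSpace ℝ (Fin n) → ℝ) :
    weightedOpNorm p w (bochnerRiesz lam 1) ≤ weightedOpNorm p w (maximalBochnerRiesz lam) := by
  unfold weightedOpNorm
  refine iSup₂_mono fun f _ => ENNReal.div_le_div_right ?_ _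
  refine eLpNorm_mono_enorm fun x => ?_
  rw [enorm_eq_self]
  exact le_iSup₂_of_le (f := fun (R : ℝ) (_ : 0 < R) => ‖bochnerRiesz lam R f x‖ₑ) 1 one_pos le_rfl

end

theorem corollary3p3 (n : ℕ) (hn : 2 ≤ n) (p : ℝ) (hp : 1 < p) (β : ℝ) :
    ((∃ c : ℝ, ∀ w : EuclideanSpace ℝ (Fin n) → ℝ, IsApWeight p w →
        weightedOpNorm p w (bochnerRiesz (((n : ℝ) - 1) / 2) 1) ≤
          ENNReal.ofReal c * apConst p w ^ β) →
      max 1 (1 / (p - 1)) ≤ β) ∧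
    ((∃ c : ℝ, ∀ w : EuclideanSpace ℝ (Fin n) → ℝ, IsApWeight p w →
        weightedOpNorm p w (maximalBochnerRiesz (((n : ℝ) - 1) / 2)) ≤
          ENNReal.ofReal c * apConst p w ^ β) →
      max 1 (1 / (p - 1)) ≤ β) := by
  obtain ⟨m, rfl⟩ : ∃ m, n = m + 1 := ⟨n - 1, by omega⟩
  have hm : 0 < m := by omega
  have hlam : (((m + 1 : ℕ) : ℝ) - 1) / 2 = (m : ℝ) / 2 := by
    push_cast
    ring
  rw [hlam]
  constructor
  · rintro ⟨c, hc⟩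
    exact max_le_of_weighted_bound m hm hp hc
  · rintro ⟨c, hc⟩
    exact max_le_of_weighted_bound m hm hp fun w hw =>
      (weightedOpNorm_bochnerRiesz_le_maximal p _ w).trans (hc w hw)
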